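/- Let $\Omega=\{\xi\in\mathbb R^3:|\xi|=1\}$ with surface measure $\omega$, let $\mathrm L^2(\Omega)$ and $\mathrm l^2(\Omega)$ be the spaces of square-integrable functions $\Omega\to\mathbb R$ and $\Omega\to\mathbb R^3$, and let $\mathrm L^2_0(\Omega)=\{F\in\mathrm L^2(\Omega):\int_\Omega F\,d\omega=0\}$. Let $\nabla^*$ be the (weak) surface gradient on $\Omega$, $\Delta^*=\nabla^*\cdot\nabla^*$ the Beltrami operator, and $$o^{(1)}[F](\xi)=\xi F(\xi),\qquad o^{(2)}[F]=\nabla^*F,\qquad o^{(3)}[F](\xi)=\xi\wedge\nabla^*F(\xi),\qquad D=\left(-\Delta^*+\tfrac14\right)^{1/2},$$ where the square root is taken in the sense of spectral calculus for the self-adjoint operator $-\Delta^*$ on $\mathrm L^2(\Omega)$. Put $$\bar o^{(1)}=o^{(1)}-o^{(2)}\left(D+\tfrac12\right)^{-1},\qquad \bar o^{(2)}=o^{(1)}+o^{(2)}\left(D-\tfrac12\right)^{-1},\qquad \bar o^{(3)}=o^{(3)}\left(D-\tfrac12\right)^{-1},$$ where $(D-\frac12)^{-1}$ denotes the inverse of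 $D-\frac12$ in $\mathrm L^2_0(\Omega)$, so that $\bar o^{(2)}$ and $\bar o^{(3)}$ act on $\mathrm L^2_0(\Omega)$. Theorem (Spherical Hardy–Hodge Decomposition III). Let $f\in\mathrm l^2(\Omega)$. There are unique $F_1\in\mathrm L^2(\Omega)$ and $F_2,F_3\in\mathrm L^2_0(\Omega)$, where $F_2,F_3$ have square-integrable surface gradients, with $f=o^{(1)}[F_1]+o^{(2)}[F_2]+o^{(3)}[F_3]$ (the Helmholtz scalars of $f$). Moreover, $f$ can be decomposed into $$f=\bar o^{(1)}[\bar F_1]+\bar o^{(2)}[\bar F_2]+\bar o^{(3)}[\bar F_3],$$ where the scalar functions $\bar F_1,\bar F_2,\bar F_3\in\mathrm L^2(\Omega)$ are uniquely determined by the conditions $\int_\Omega\bar F_2\,d\omega=\int_\Omega\bar F_3\,d\omega=0$. They are given by $$\bar F_1=\tfrac12\left(F_1+\tfrac12D^{-1}[F_1]-D[F_2]+\tfrac14D^{-1}[F_2]\right),$$ $$\bar F_2=\tfrac12\left(F_1-\tfrac12D^{-1}[F_1]+D[F_2]-\tfrac14D^{-1}[F_2]\right),$$ $$\bar F_3=D[F_3]-\tfrac12F_3,$$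 where $F_2$ and $F_3$ lie in the domain of $D$. -/

import Mathlib

open MeasureTheory
open scoped ContDiff InnerProductSpace

namespace SphereHH

/-- Euclidean three-space. -/
abbrev E3 : Type := EuclideanSpace ℝ (Fin 3)

/-- The unit sphere `Ω` of three-space. -/
abbrev Sph : Type := Metric.sphere (0 : E3) 1

/-- The surface measure `ω` of the unit sphere (total mass `4π`). -/
noncomputable abbrev surf : Measure Sph := (volume : Measure E3).toSphere

/-- The real space `L²(Ω)` of square-integrable scalar fields. -/
abbrev ScalarL2 : Type := Lp ℝ 2 surf

/-- The space `l²(Ω)` of square-integrable (not necessarily tangential) vector fields. -/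
abbrev VectorL2 : Type := Lp E3 2 surf

/-! ### Differential operators of smooth functions

Smooth functions on the sphere are represented by smooth functions on three-space. At a point of
the sphere the values below depend only on the restriction of the function to the sphere. -/

/-- `∇* = r ∇ - r ξ ∂/∂r`, at a point `ξ` of the unit sphere (`r = 1`). -/
noncomputable def surfaceGrad (Φ : E3 → ℝ) (ξ : E3) : E3 :=
  gradient Φ ξ - deriv (fun r : ℝ => Φ (r • ξ)) 1 • ξ

/-- The surface divergence `∇* · φ`, at a point of the unit sphere. -/
noncomputable def surfaceDiv (φ : E3 → E3) (ξ : E3) : ℝ :=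
  ∑ i : Fin 3, surfaceGrad (fun x => φ x i) ξ i

/-- The Beltrami operator `Δ* = r² Δ - ∂/∂r (r² ∂/∂r)`, at a point `ξ` of the unit sphere. -/
noncomputable def beltrami (Φ : E3 → ℝ) (ξ : E3) : ℝ :=
  Laplacian.laplacian Φ ξ
    - deriv (fun r : ℝ => r ^ 2 * deriv (fun s : ℝ => Φ (s • ξ)) r) 1

/-! ### The operators `o⁽¹⁾`, `o⁽²⁾`, `o⁽³⁾` on square-integrable functions -/

theorem memLp_normal (F : ScalarL2) :
    MemLp (fun ξ : Sph => F ξ • (ξ : E3)) 2 surf := by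
  refine (Lp.memLp F).of_le ?_ ?_
  · exact (Lp.aestronglyMeasurable F).smul continuous_subtype_val.aestronglyMeasurable
  · refine Filter.Eventually.of_forall fun ξ => ?_
    have h : ‖(ξ : E3)‖ = 1 := by simp
    rw [norm_smul, h, mul_one]

/-- `o⁽¹⁾[F](ξ) = ξ F(ξ)`. -/
noncomputable def o1 (F : ScalarL2) : VectorL2 := (memLp_normal F).toLp _

/-- `IsO2 F g`: the scalar field `F` has a square-integrable weak surface gradient, and
`o⁽²⁾[F] = ∇* F = g`. Test fields are all smooth tangential vector fields on the sphere. -/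
def IsO2 (F : ScalarL2) (g : VectorL2) : Prop :=
  (∀ᵐ ξ : Sph ∂surf, ⟪(ξ : E3), g ξ⟫_ℝ = 0) ∧
  ∀ φ : E3 → E3, ContDiff ℝ ∞ φ → (∀ ξ : Sph, ⟪(ξ : E3), φ ξ⟫_ℝ = 0) →
    ∫ ξ : Sph, ⟪g ξ, φ ξ⟫_ℝ ∂surf = - ∫ ξ : Sph, F ξ * surfaceDiv φ ξ ∂surf

/-- The vector product of three-space. -/
noncomputable def cross (x y : E3) : E3 := WithLp.toLp 2 (crossProduct x.ofLp y.ofLp)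

/-- `IsO3 F h`: the scalar field `F` has a square-integrable weak surface curl gradient, and
`o⁽³⁾[F] = L* F = ξ ∧ ∇* F = h`. -/
def IsO3 (F : ScalarL2) (h : VectorL2) : Prop :=
  ∃ g : VectorL2, IsO2 F g ∧ ∀ᵐ ξ : Sph ∂surf, h ξ = cross ξ (g ξ)

/-! ### The operator `D = (-Δ* + 1/4)^{1/2}` and its relatives -/

/-- `IsD F G`: the scalar field `F` lies in the domain of `D = (-Δ* + 1/4)^{1/2}`, and `D[F] = G`.
The square root is the one of spectral calculus: the self-adjoint operator `-Δ*` has a complete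
system of smooth eigenfunctions, and `D` multiplies the component of `F` along an eigenfunction
with eigenvalue `l` by `(l + 1/4)^{1/2}`. -/
def IsD (F G : ScalarL2) : Prop :=
  ∀ (l : ℝ) (Y : E3 → ℝ), ContDiff ℝ ∞ Y → (∀ ξ : Sph, -beltrami Y ξ = l * Y ξ) →
    ∫ ξ : Sph, G ξ * Y ξ ∂surf = √(l + 1 / 4) * ∫ ξ : Sph, F ξ * Y ξ ∂surf

/-- `D⁻¹[F] = G`. -/
def IsDInv (F G : ScalarL2) : Prop := IsD G F

/-- `(D + 1/2)⁻¹[F] = G`, i.e. `D[G] + G/2 = F`. -/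
def IsDAddHalfInv (F G : ScalarL2) : Prop := IsD G (F - (1 / 2 : ℝ) • G)

/-- `(D - 1/2)⁻¹[F] = G`, i.e. `D[G] - G/2 = F`, the inverse being taken in the space
`L²₀(Ω)` of scalar fields with mean zero. -/
def IsDSubHalfInv (F G : ScalarL2) : Prop :=
  ∫ ξ, F ξ ∂surf = 0 ∧ ∫ ξ, G ξ ∂surf = 0 ∧ IsD G (F + (1 / 2 : ℝ) • G)

/-- `ō⁽¹⁾[F] = f`, where `ō⁽¹⁾ = o⁽¹⁾ - o⁽²⁾ (D + 1/2)⁻¹`. -/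
def IsObar1 (F : ScalarL2) (f : VectorL2) : Prop :=
  ∃ (G : ScalarL2) (g : VectorL2), IsDAddHalfInv F G ∧ IsO2 G g ∧ f = o1 F - g

/-- `ō⁽²⁾[F] = f`, where `ō⁽²⁾ = o⁽¹⁾ + o⁽²⁾ (D - 1/2)⁻¹`. -/
def IsObar2 (F : ScalarL2) (f : VectorL2) : Prop :=
  ∃ (G : ScalarL2) (g : VectorL2), IsDSubHalfInv F G ∧ IsO2 G g ∧ f = o1 F + g

/-- `ō⁽³⁾[F] = f`, where `ō⁽³⁾ = o⁽³⁾ (D - 1/2)⁻¹`. -/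
def IsObar3 (F : ScalarL2) (f : VectorL2) : Prop :=
  ∃ G : ScalarL2, IsDSubHalfInv F G ∧ IsO3 G f

/-- `F₁, F₂, F₃` are Helmholtz scalars of `f`: `f = o⁽¹⁾[F₁] + o⁽²⁾[F₂] + o⁽³⁾[F₃]`, where `F₂`
and `F₃` have mean zero. -/
def IsHelmholtz (f : VectorL2) (F₁ F₂ F₃ : ScalarL2) : Prop :=
  ∫ ξ, F₂ ξ ∂surf = 0 ∧ ∫ ξ, F₃ ξ ∂surf = 0 ∧
  ∃ g h : VectorL2, IsO2 F₂ g ∧ IsO3 F₃ h ∧ f = o1 F₁ + g + h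

/-- `f = ō⁽¹⁾[F₁] + ō⁽²⁾[F₂] + ō⁽³⁾[F₃]`, where `F₂` and `F₃` have mean zero. -/
def IsHardyHodge (f : VectorL2) (F₁ F₂ F₃ : ScalarL2) : Prop :=
  ∫ ξ, F₂ ξ ∂surf = 0 ∧ ∫ ξ, F₃ ξ ∂surf = 0 ∧
  ∃ f₁ f₂ f₃ : VectorL2, IsObar1 F₁ f₁ ∧ IsObar2 F₂ f₂ ∧ IsObar3 F₃ f₃ ∧ f = f₁ + f₂ + f₃

end SphereHH

/-!
The operator `-Δ*` is diagonalized by the spherical harmonics, with eigenvalue `n (n + 1)` in degree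
`n`; hence `D` is multiplication by `n + 1/2`, and `D - 1/2`, `D + 1/2` are multiplication by `n`
and `n + 1` (`isD_iff`, `isDSubHalfInv_iff`, `isDAddHalfInv_iff`). A function has a weak surface
gradient in `L²` exactly if `∑ n (n + 1) ‖Fₙ‖²` converges (`IsO2.summable`, `exists_isO2`), which is
the domain of `D`.

On the sphere, `∇*`, `L* = ξ ∧ ∇*` and `Δ* = ∑ₖ (L*ₖ)²` are given by the derivations `x ∧ ∇` of the
algebra of smooth functions on three-space, and integration by parts is the rotation invariance of
the surface measure (`integral_rot`). Completeness of the spherical harmonics needs no harmonic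
polynomials: `Δ* + n (n + 1)` lowers the degree of polynomials of degree `n` on the sphere, so every
polynomial is a sum of eigenfunctions (`exists_harm_sum`), and polynomials are dense.

For the Helmholtz decomposition, the gradients of functions with mean zero form a closed subspace by
Poincaré's inequality, gradients and curl gradients are orthogonal, and together they exhaust the
tangential fields. The last point rests on the identity `tgrad_tgrad_add_rot_rot`: if a tangential
field is orthogonal to both kinds, then its Cartesian components are orthogonal to the range of
`Δ*`, hence constant, hence zero (`eq_zero_of_orthogonal`).

Writing `G₁ = (D + 1/2)⁻¹ B₁`, `G₂ = (D - 1/2)⁻¹ B₂`, `G₃ = (D - 1/2)⁻¹ B₃`, a Hardy-Hodge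
decomposition reads `f = o⁽¹⁾[B₁ + B₂] + o⁽²⁾[G₂ - G₁] + o⁽³⁾[G₃]`. By uniqueness of the Helmholtz
scalars this is, in each degree, a regular linear system for `B₁, B₂, B₃`, whose solution is the
asserted formula (`IsHardyHodge.proj_eq`).
-/

namespace SphereHH

/-! ### Smooth functions and their derivations -/

/-- The algebra of smooth real functions on three-space. Smooth functions on the sphere are
represented by their smooth extensions, so that differential operators become derivations and
their identities become identities in a commutative ring. -/
def Smooth : Subalgebra ℝ (E3 → ℝ) where
  carrier := {f | ContDiff ℝ ∞ f}
  mul_mem' {a b} (ha : ContDiff ℝ ∞ a) (hb : ContDiff ℝ ∞ b) := ha.mul hb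
  add_mem' {a b} (ha : ContDiff ℝ ∞ a) (hb : ContDiff ℝ ∞ b) := ha.add hb
  algebraMap_mem' r := (contDiff_const : ContDiff ℝ ∞ fun _ : E3 => r)

namespace Smooth

theorem contDiff (Φ : Smooth) : ContDiff ℝ ∞ (Φ : E3 → ℝ) := Φ.2

theorem differentiable (Φ : Smooth) : Differentiable ℝ (Φ : E3 → ℝ) :=
  (Smooth.contDiff Φ).differentiable (by simp)

theorem continuous (Φ : Smooth) : Continuous (Φ : E3 → ℝ) := (Smooth.contDiff Φ).continuous

@[ext] theorem ext {Φ Ψ : Smooth} (h : ∀ x, (Φ : E3 → ℝ) x = (Ψ : E3 → ℝ) x) : Φ = Ψ :=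
  Subtype.ext (funext h)

@[simp] theorem add_apply (Φ Ψ : Smooth) (x : E3) :
    ((Φ + Ψ : Smooth) : E3 → ℝ) x = (Φ : E3 → ℝ) x + (Ψ : E3 → ℝ) x := rfl

@[simp] theorem sub_apply (Φ Ψ : Smooth) (x : E3) :
    ((Φ - Ψ : Smooth) : E3 → ℝ) x = (Φ : E3 → ℝ) x - (Ψ : E3 → ℝ) x := rfl

@[simp] theorem mul_apply (Φ Ψ : Smooth) (x : E3) :
    ((Φ * Ψ : Smooth) : E3 → ℝ) x = (Φ : E3 → ℝ) x * (Ψ : E3 → ℝ) x := rfl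

@[simp] theorem smul_apply (c : ℝ) (Φ : Smooth) (x : E3) :
    ((c • Φ : Smooth) : E3 → ℝ) x = c * (Φ : E3 → ℝ) x := rfl

@[simp] theorem zero_apply (x : E3) : ((0 : Smooth) : E3 → ℝ) x = 0 := rfl
@[simp] theorem one_apply (x : E3) : ((1 : Smooth) : E3 → ℝ) x = 1 := rfl

/-- Evaluation at a point, as a homomorphism of algebras. -/
def evalAt (x : E3) : Smooth →ₐ[ℝ] ℝ := (Pi.evalAlgHom ℝ (fun _ : E3 => ℝ) x).comp Smooth.val

@[simp] theorem sum_apply {ι : Type*} (s : Finset ι) (Φ : ι → Smooth) (x : E3) :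
    ((∑ i ∈ s, Φ i : Smooth) : E3 → ℝ) x = ∑ i ∈ s, (Φ i : E3 → ℝ) x :=
  map_sum (evalAt x) Φ s

end Smooth

/-- The partial derivative in the `i`-th coordinate direction. -/
noncomputable def pd (i : Fin 3) : Derivation ℝ Smooth Smooth where
  toFun Φ := ⟨fun x => fderiv ℝ (Φ : E3 → ℝ) x (EuclideanSpace.single i 1),
    ((Smooth.contDiff Φ).fderiv_right (m := ∞) (by simp)).clm_apply contDiff_const⟩
  map_add' Φ Ψ := by
    ext x
    change fderiv ℝ ((Φ : E3 → ℝ) + (Ψ : E3 → ℝ)) x _ = _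
    rw [fderiv_add ((Smooth.differentiable Φ) x) ((Smooth.differentiable Ψ) x)]
    rfl
  map_smul' c Φ := by
    ext x
    change fderiv ℝ (c • (Φ : E3 → ℝ)) x _ = _
    rw [fderiv_const_smul ((Smooth.differentiable Φ) x)]
    rfl
  map_one_eq_zero' := by
    ext x
    change fderiv ℝ (fun _ : E3 => (1 : ℝ)) x _ = _
    simp
  leibniz' Φ Ψ := by
    ext x
    change fderiv ℝ ((Φ : E3 → ℝ) * (Ψ : E3 → ℝ)) x _ = _
    rw [fderiv_mul ((Smooth.differentiable Φ) x) ((Smooth.differentiable Ψ) x)]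
    rfl

theorem pd_apply (i : Fin 3) (Φ : Smooth) (x : E3) :
    (pd i Φ : E3 → ℝ) x = fderiv ℝ (Φ : E3 → ℝ) x (EuclideanSpace.single i 1) := rfl

theorem fderiv_eq_sum (Φ : Smooth) (x v : E3) :
    fderiv ℝ (Φ : E3 → ℝ) x v = ∑ i, v i * (pd i Φ : E3 → ℝ) x := by
  have hv : v = ∑ i, v i • EuclideanSpace.single i (1 : ℝ) := by
    ext j
    simp [Finset.sum_apply, Pi.single_apply]
  conv_lhs => rw [hv]
  simp [map_sum, pd_apply]

theorem fderiv_pd (Φ : Smooth) (x v : E3) (i : Fin 3) :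
    fderiv ℝ (pd i Φ : E3 → ℝ) x v
      = fderiv ℝ (fderiv ℝ (Φ : E3 → ℝ)) x v (EuclideanSpace.single i 1) := by
  have hd : DifferentiableAt ℝ (fderiv ℝ (Φ : E3 → ℝ)) x :=
    ((Smooth.contDiff Φ).fderiv_right (m := ∞) (by simp)).differentiable (by simp) x
  have : (pd i Φ : E3 → ℝ) = fun y => fderiv ℝ (Φ : E3 → ℝ) y (EuclideanSpace.single i 1) := rfl
  rw [this, fderiv_clm_apply hd (differentiableAt_const _)]
  simp

theorem pd_comm (i j : Fin 3) (Φ : Smooth) : pd i (pd j Φ) = pd j (pd i Φ) := by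
  ext x
  rw [pd_apply, pd_apply, fderiv_pd, fderiv_pd]
  exact ((Smooth.contDiff Φ).contDiffAt (x := x)).isSymmSndFDerivAt
    (by simpa using (mod_cast le_top : ((2 : ℕ∞) : WithTop ℕ∞) ≤ ∞)) _ _

/-- The `i`-th coordinate function. -/
noncomputable def X (i : Fin 3) : Smooth :=
  ⟨fun x => x i,
    ContinuousLinearMap.contDiff (n := ∞) (EuclideanSpace.proj (𝕜 := ℝ) i : E3 →L[ℝ] ℝ)⟩

@[simp] theorem X_apply (i : Fin 3) (x : E3) : (X i : E3 → ℝ) x = x i := rfl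

theorem pd_X (i j : Fin 3) : pd i (X j) = if i = j then 1 else 0 := by
  ext x
  rw [pd_apply]
  change fderiv ℝ (EuclideanSpace.proj (𝕜 := ℝ) j : E3 →L[ℝ] ℝ) x _ = _
  rw [ContinuousLinearMap.fderiv]
  rcases eq_or_ne i j with h | h
  · subst h; simp
  · simp [h, h.symm]

/-- The squared norm `|x|²`. -/
noncomputable def normSq : Smooth := ∑ i, X i * X i

theorem normSq_apply (x : E3) : (normSq : E3 → ℝ) x = ‖x‖ ^ 2 := by
  rw [EuclideanSpace.real_norm_sq_eq]
  simp [normSq, sq]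

@[simp] theorem normSq_sphere (ξ : Sph) : (normSq : E3 → ℝ) ξ = 1 := by
  rw [normSq_apply]; simp

/-- The Euler derivation `x · ∇`. -/
noncomputable def euler : Derivation ℝ Smooth Smooth := ∑ i, X i • pd i

/-- The Euclidean Laplacian. -/
noncomputable def lap : Smooth →ₗ[ℝ] Smooth :=
  ∑ i, (pd i : Smooth →ₗ[ℝ] Smooth) ∘ₗ (pd i : Smooth →ₗ[ℝ] Smooth)

/-- The components of the surface curl gradient `L* = x ∧ ∇`; these are derivations that annihilate
`|x|²`. Indices are taken modulo three. -/
noncomputable def rot (i : Fin 3) : Derivation ℝ Smooth Smooth :=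
  X (i + 1) • pd (i + 2) - X (i + 2) • pd (i + 1)

/-- The components of `|x|² ∇ - x (x · ∇)`, which is the surface gradient on the unit sphere; this
polynomial extension is tangential on all of three-space. -/
noncomputable def tgrad (i : Fin 3) : Derivation ℝ Smooth Smooth :=
  normSq • pd i - X i • euler

/-- `∑ₖ (x ∧ ∇)ₖ²`, which is the Beltrami operator on the unit sphere. -/
noncomputable def bel : Smooth →ₗ[ℝ] Smooth :=
  ∑ i, (rot i : Smooth →ₗ[ℝ] Smooth) ∘ₗ (rot i : Smooth →ₗ[ℝ] Smooth)

theorem euler_apply (Φ : Smooth) : euler Φ = ∑ i, X i * pd i Φ := by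
  simp [euler, Fin.sum_univ_three]

theorem lap_apply (Φ : Smooth) : lap Φ = ∑ i, pd i (pd i Φ) := by
  simp [lap]

theorem rot_apply (i : Fin 3) (Φ : Smooth) :
    rot i Φ = X (i + 1) * pd (i + 2) Φ - X (i + 2) * pd (i + 1) Φ := rfl

theorem tgrad_apply (i : Fin 3) (Φ : Smooth) : tgrad i Φ = normSq * pd i Φ - X i * euler Φ := rfl

theorem bel_apply (Φ : Smooth) : bel Φ = ∑ i, rot i (rot i Φ) := by
  simp [bel]

/-! ### Identities between the differential operators -/

theorem fin3_11 : (1 : Fin 3) + 1 = 2 := rfl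
theorem fin3_12 : (1 : Fin 3) + 2 = 0 := rfl
theorem fin3_21 : (2 : Fin 3) + 1 = 0 := rfl
theorem fin3_22 : (2 : Fin 3) + 2 = 1 := rfl

theorem bel_eq (Φ : Smooth) : bel Φ = normSq * lap Φ - euler (euler Φ) - euler Φ := by
  simp [bel_apply, rot_apply, lap_apply, euler_apply, normSq, Fin.sum_univ_three, pd_X,
    fin3_11, fin3_12, fin3_21, fin3_22,
    pd_comm 1 0, pd_comm 2 0, pd_comm 2 1]
  ring


/-- The components of the vector product of the position vector with a vector field. -/
noncomputable def posCross (w : Fin 3 → Smooth) (k : Fin 3) : Smooth :=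
  X (k + 1) * w (k + 2) - X (k + 2) * w (k + 1)

/-- The surface divergence as a sum of derivatives along infinitesimal rotations; the last term
vanishes for tangential fields. -/
theorem sum_tgrad_eq (w : Fin 3 → Smooth) :
    ∑ i, tgrad i (w i) = ∑ k, rot k (posCross w k) + 2 * ∑ i, X i * w i := by
  simp [posCross, rot_apply, tgrad_apply, euler_apply, normSq, Fin.sum_univ_three, pd_X,
    fin3_11, fin3_12, fin3_21, fin3_22]
  ring

theorem posCross_tgrad (Ψ : Smooth) (k : Fin 3) :
    posCross (fun i => tgrad i Ψ) k = normSq * rot k Ψ := by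
  simp only [posCross, rot_apply, tgrad_apply]
  ring

theorem sum_X_mul_rot (Ψ : Smooth) : ∑ i, X i * rot i Ψ = 0 := by
  simp [rot_apply, Fin.sum_univ_three, fin3_11, fin3_12, fin3_21, fin3_22]
  ring

theorem sum_X_mul_tgrad (Ψ : Smooth) : ∑ i, X i * tgrad i Ψ = 0 := by
  simp [tgrad_apply, Fin.sum_univ_three, euler_apply, normSq]
  ring

theorem sum_tgrad_rot (Ψ : Smooth) : ∑ i, tgrad i (rot i Ψ) = 0 := by
  simp [rot_apply, tgrad_apply, euler_apply, normSq, Fin.sum_univ_three, pd_X,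
    fin3_11, fin3_12, fin3_21, fin3_22, pd_comm 1 0, pd_comm 2 0, pd_comm 2 1]
  ring

set_option maxHeartbeats 1600000 in
/-- The identity behind the completeness of gradients and curl gradients: on the sphere it says
that the tangential part of the field `eᵢ Δ*Φ` is the gradient of `(∇*Φ)ᵢ` plus the curl gradient
of `(L*Φ)ᵢ`. -/
theorem tgrad_tgrad_add_rot_rot (i j : Fin 3) (Φ : Smooth) :
    tgrad j (tgrad i Φ) + normSq * rot j (rot i Φ)
      = ((if i = j then normSq else 0) - X i * X j) * bel Φ := by
  rw [bel_eq]
  simp only [rot_apply, tgrad_apply, euler_apply, lap_apply, normSq, Fin.sum_univ_three, pd_X,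
      map_add, map_sub, Derivation.leibniz, smul_eq_mul]
  fin_cases i <;> fin_cases j <;>
  · simp [fin3_11, fin3_12, fin3_21, fin3_22, pd_comm 1 0, pd_comm 2 0, pd_comm 2 1]
    ring

theorem sum_tgrad_tgrad (Ψ : Smooth) : ∑ i, tgrad i (tgrad i Ψ) = normSq * bel Ψ := by
  have h := Finset.sum_congr (rfl : (Finset.univ : Finset (Fin 3)) = Finset.univ)
    fun i _ => tgrad_tgrad_add_rot_rot i i Ψ
  rw [Finset.sum_add_distrib, ← Finset.mul_sum, ← bel_apply, ← Finset.sum_mul] at h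
  simp only [if_true, Finset.sum_sub_distrib, Finset.sum_const, Finset.card_univ,
    Fintype.card_fin] at h
  change _ = (3 • normSq - normSq) * bel Ψ at h
  rw [nsmul_eq_mul] at h
  push_cast at h
  linear_combination h

/-! ### The differential operators on the sphere -/

theorem gradient_apply (Φ : Smooth) (x : E3) (i : Fin 3) :
    gradient (Φ : E3 → ℝ) x i = (pd i Φ : E3 → ℝ) x := by
  have h := InnerProductSpace.toDual_symm_apply (𝕜 := ℝ) (x := EuclideanSpace.single i (1 : ℝ))
    (y := fderiv ℝ (Φ : E3 → ℝ) x)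
  rw [pd_apply, ← h, EuclideanSpace.inner_single_right]
  simp [gradient]

theorem hasDerivAt_comp_smul (Φ : Smooth) (x : E3) (r : ℝ) :
    HasDerivAt (fun s : ℝ => (Φ : E3 → ℝ) (s • x)) (∑ i, x i * (pd i Φ : E3 → ℝ) (r • x)) r := by
  rw [← fderiv_eq_sum]
  have h1 : HasDerivAt (fun s : ℝ => s • x) ((1 : ℝ) • x) r := (hasDerivAt_id r).smul_const x
  rw [one_smul] at h1
  exact (Smooth.differentiable Φ (r • x)).hasFDerivAt.comp_hasDerivAt r h1

theorem surfaceGrad_apply (Φ : Smooth) (ξ : Sph) (i : Fin 3) :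
    surfaceGrad (Φ : E3 → ℝ) ξ i = (tgrad i Φ : E3 → ℝ) ξ := by
  rw [surfaceGrad, (hasDerivAt_comp_smul Φ ξ 1).deriv]
  simp [gradient_apply, tgrad_apply, euler_apply]
  ring

theorem beltrami_apply (Φ : Smooth) (ξ : Sph) : beltrami (Φ : E3 → ℝ) ξ = (bel Φ : E3 → ℝ) ξ := by
  have h1 : Laplacian.laplacian (Φ : E3 → ℝ) ξ = (lap Φ : E3 → ℝ) ξ := by
    rw [InnerProductSpace.laplacian_eq_iteratedFDeriv_orthonormalBasis _
      (EuclideanSpace.basisFun (Fin 3) ℝ), lap_apply, Smooth.sum_apply]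
    refine Finset.sum_congr rfl fun i _ => ?_
    rw [iteratedFDeriv_two_apply, pd_apply, fderiv_pd]
    simp
  have h2 : (fun r : ℝ => r ^ 2 * deriv (fun s : ℝ => (Φ : E3 → ℝ) (s • (ξ : E3))) r)
      = fun r : ℝ => r * (euler Φ : E3 → ℝ) (r • (ξ : E3)) := by
    funext r
    rw [(hasDerivAt_comp_smul Φ ξ r).deriv, euler_apply, Smooth.sum_apply, Finset.mul_sum,
      Finset.mul_sum]
    refine Finset.sum_congr rfl fun i _ => ?_
    simp
    ring
  have h3 : HasDerivAt (fun r : ℝ => r * (euler Φ : E3 → ℝ) (r • (ξ : E3))) _ 1 :=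
    (hasDerivAt_id (1 : ℝ)).mul (hasDerivAt_comp_smul (euler Φ) ξ 1)
  rw [beltrami, h1, h2, h3.deriv, bel_eq, euler_apply (euler Φ)]
  simp
  ring

/-- The vector field with given components. -/
noncomputable def vec (w : Fin 3 → Smooth) (x : E3) : E3 :=
  WithLp.toLp 2 fun i => (w i : E3 → ℝ) x

@[simp] theorem vec_apply (w : Fin 3 → Smooth) (x : E3) (i : Fin 3) :
    vec w x i = (w i : E3 → ℝ) x := rfl

theorem contDiff_vec (w : Fin 3 → Smooth) : ContDiff ℝ ∞ (vec w) :=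
  contDiff_euclidean.2 fun i => Smooth.contDiff (w i)

/-- The components of a smooth vector field. -/
noncomputable def comps (φ : E3 → E3) (hφ : ContDiff ℝ ∞ φ) (i : Fin 3) : Smooth :=
  ⟨fun x => φ x i, contDiff_euclidean.1 hφ i⟩

theorem vec_comps (φ : E3 → E3) (hφ : ContDiff ℝ ∞ φ) : vec (comps φ hφ) = φ := rfl

theorem inner_eq_sum (x y : E3) : ⟪x, y⟫_ℝ = ∑ i, x i * y i := by
  rw [PiLp.inner_apply]
  exact Finset.sum_congr rfl fun i _ => mul_comm _ _

theorem inner_pos_vec (w : Fin 3 → Smooth) (x : E3) :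
    ⟪x, vec w x⟫_ℝ = ((∑ i, X i * w i : Smooth) : E3 → ℝ) x := by
  simp [inner_eq_sum]

theorem surfaceDiv_vec (w : Fin 3 → Smooth) (ξ : Sph) :
    surfaceDiv (vec w) ξ = ((∑ i, tgrad i (w i) : Smooth) : E3 → ℝ) ξ := by
  rw [surfaceDiv, Smooth.sum_apply]
  exact Finset.sum_congr rfl fun i _ => surfaceGrad_apply (w i) ξ i

theorem cross_apply (x y : E3) (i : Fin 3) :
    cross x y i = x (i + 1) * y (i + 2) - x (i + 2) * y (i + 1) := by
  fin_cases i <;> simp [cross, _root_.cross_apply, fin3_11, fin3_12, fin3_21, fin3_22]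

theorem cross_vec (w : Fin 3 → Smooth) (x : E3) : cross x (vec w x) = vec (posCross w) x := by
  ext i
  simp [cross_apply, posCross]

/-! ### Rotation invariance and integration by parts -/

theorem integrable_smooth (Φ : Smooth) : Integrable (fun ξ : Sph => (Φ : E3 → ℝ) ξ) surf :=
  ((Smooth.continuous Φ).comp continuous_subtype_val).integrable_of_hasCompactSupport
    (HasCompactSupport.of_compactSpace _)

/-- The rotation by the angle `t` about the `k`-th coordinate axis. -/
noncomputable def axisRot (k : Fin 3) (t : ℝ) : E3 →ₗᵢ[ℝ] E3 where
  toFun x := WithLp.toLp 2 fun j => if j = k then x k else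
    if j = k + 1 then Real.cos t * x (k + 1) - Real.sin t * x (k + 2)
    else Real.sin t * x (k + 1) + Real.cos t * x (k + 2)
  map_add' x y := by
    ext j
    simp only [PiLp.add_apply]
    split_ifs <;> ring
  map_smul' c x := by
    ext j
    simp only [PiLp.smul_apply, smul_eq_mul, RingHom.id_apply]
    split_ifs <;> ring
  norm_map' x := by
    rw [← sq_eq_sq₀ (norm_nonneg _) (norm_nonneg _), EuclideanSpace.real_norm_sq_eq,
      EuclideanSpace.real_norm_sq_eq]
    have h := Real.sin_sq_add_cos_sq t
    fin_cases k <;> simp [Fin.sum_univ_three, fin3_11, fin3_12, fin3_21, fin3_22]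
    · linear_combination (x 1 ^ 2 + x 2 ^ 2) * h
    · linear_combination (x 2 ^ 2 + x 0 ^ 2) * h
    · linear_combination (x 0 ^ 2 + x 1 ^ 2) * h

theorem axisRot_apply (k : Fin 3) (t : ℝ) (x : E3) (j : Fin 3) :
    axisRot k t x j = if j = k then x k else
      if j = k + 1 then Real.cos t * x (k + 1) - Real.sin t * x (k + 2)
      else Real.sin t * x (k + 1) + Real.cos t * x (k + 2) := rfl

theorem hasDerivAt_comp_axisRot (Φ : Smooth) (k : Fin 3) (x : E3) (t : ℝ) :
    HasDerivAt (fun s => (Φ : E3 → ℝ) (axisRot k s x)) ((rot k Φ : E3 → ℝ) (axisRot k t x)) t := by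
  set v : E3 := WithLp.toLp 2 fun j => if j = k then 0 else
    if j = k + 1 then -(axisRot k t x (k + 2)) else axisRot k t x (k + 1) with hv
  have h : HasDerivAt (fun s => axisRot k s x) v t := by
    have hL : ∀ w : ℝ → Fin 3 → ℝ, HasDerivAt w v.ofLp t →
        HasDerivAt (fun s => (WithLp.toLp 2 (w s) : E3)) v t := fun w hw =>
      (PiLp.hasFDerivAt_toLp (𝕜 := ℝ) 2 (w t)).comp_hasDerivAt t hw
    refine hL (fun s => (axisRot k s x).ofLp) (hasDerivAt_pi.2 fun j => ?_)
    have hs := Real.hasDerivAt_sin t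
    have hc := Real.hasDerivAt_cos t
    simp only [axisRot_apply, hv]
    have h1 : k + 2 ≠ k := by fin_cases k <;> decide
    have h2 : k + 2 ≠ k + 1 := by fin_cases k <;> decide
    have h3 : k + 1 ≠ k := by fin_cases k <;> decide
    split_ifs
    · exact hasDerivAt_const _ _
    · exact ((hc.mul_const (x (k + 1))).sub (hs.mul_const (x (k + 2)))).congr_deriv (by ring)
    · exact ((hs.mul_const (x (k + 1))).add (hc.mul_const (x (k + 2)))).congr_deriv (by ring)
  refine ((Smooth.differentiable Φ (axisRot k t x)).hasFDerivAt.comp_hasDerivAt t h).congr_deriv ?_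
  rw [fderiv_eq_sum]
  simp only [hv, rot_apply]
  fin_cases k <;> simp [Fin.sum_univ_three, fin3_11, fin3_12, fin3_21, fin3_22] <;> ring

/-- The rotation as a self-map of the sphere. -/
noncomputable def sphRot (k : Fin 3) (t : ℝ) (ξ : Sph) : Sph :=
  ⟨axisRot k t ξ, by simp⟩

theorem continuous_sphRot (k : Fin 3) (t : ℝ) : Continuous (sphRot k t) :=
  ((axisRot k t).continuous.comp continuous_subtype_val).subtype_mk _

open scoped Pointwise in
theorem measurePreserving_sphRot (k : Fin 3) (t : ℝ) :
    MeasurePreserving (sphRot k t) surf surf := by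
  refine ⟨(continuous_sphRot k t).measurable, ?_⟩
  set e : E3 ≃ₗᵢ[ℝ] E3 := (axisRot k t).toLinearIsometryEquiv rfl
  ext s hs
  rw [Measure.map_apply (continuous_sphRot k t).measurable hs, Measure.toSphere_apply' _ hs,
    Measure.toSphere_apply' _ ((continuous_sphRot k t).measurable hs)]
  congr 1
  rw [← e.measurePreserving.measure_preimage_emb e.toHomeomorph.measurableEmbedding
    (Set.Ioo (0 : ℝ) 1 • ((Subtype.val : Sph → E3) '' s))]
  congr 1
  ext x
  simp only [Set.mem_smul, Set.mem_preimage, Set.mem_image]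
  constructor
  · rintro ⟨r, hr, y, ⟨η, hη, rfl⟩, h⟩
    exact ⟨r, hr, _, ⟨sphRot k t η, hη, rfl⟩, by rw [← h, map_smul]; rfl⟩
  · rintro ⟨r, hr, y, ⟨η, hη, rfl⟩, h⟩
    have h1 : sphRot k t ⟨e.symm η, by simp⟩ = η :=
      Subtype.ext (e.apply_symm_apply _)
    refine ⟨r, hr, e.symm η, ⟨⟨e.symm η, by simp⟩, ?_, rfl⟩, ?_⟩
    · rwa [h1]
    · apply e.injective
      rw [map_smul, e.apply_symm_apply, h]

/-- Rotation invariance of the surface measure, in infinitesimal form: the derivative at angle zero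
of the constant function `t ↦ ∫ Φ(R_t ξ)` vanishes. -/
theorem integral_rot (k : Fin 3) (Φ : Smooth) :
    ∫ ξ : Sph, (rot k Φ : E3 → ℝ) ξ ∂surf = 0 := by
  obtain ⟨C, hC⟩ := (isCompact_sphere (0 : E3) 1).exists_bound_of_continuousOn
    (Smooth.continuous (rot k Φ)).continuousOn
  have hcont : ∀ (Ψ : Smooth) (t : ℝ), Continuous fun ξ : Sph => (Ψ : E3 → ℝ) (axisRot k t ξ) :=
    fun Ψ t => (Smooth.continuous Ψ).comp
      ((axisRot k t).continuous.comp continuous_subtype_val)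
  have hint : ∀ (Ψ : Smooth) (t : ℝ),
      Integrable (fun ξ : Sph => (Ψ : E3 → ℝ) (axisRot k t ξ)) surf :=
    fun Ψ t => (hcont Ψ t).integrable_of_hasCompactSupport (HasCompactSupport.of_compactSpace _)
  have hd := (hasDerivAt_integral_of_dominated_loc_of_deriv_le (μ := surf) (𝕜 := ℝ)
    (F := fun t (ξ : Sph) => (Φ : E3 → ℝ) (axisRot k t ξ))
    (F' := fun t (ξ : Sph) => (rot k Φ : E3 → ℝ) (axisRot k t ξ))
    (x₀ := 0) (s := Set.univ) (bound := fun _ => C) Filter.univ_mem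
    (Filter.Eventually.of_forall fun t => (hint Φ t).aestronglyMeasurable) (hint Φ 0)
    (hint _ 0).aestronglyMeasurable
    (Filter.Eventually.of_forall fun ξ t _ => hC _ (sphRot k t ξ).2)
    (integrable_const C)
    (Filter.Eventually.of_forall fun ξ t _ => hasDerivAt_comp_axisRot Φ k ξ t)).2
  have hconst : ∀ t, ∫ ξ : Sph, (Φ : E3 → ℝ) (axisRot k t ξ) ∂surf
      = ∫ ξ : Sph, (Φ : E3 → ℝ) ξ ∂surf := by
    intro t
    have h := integral_map (μ := surf) (continuous_sphRot k t).aemeasurable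
      (f := fun ξ : Sph => (Φ : E3 → ℝ) ξ)
      ((Smooth.continuous Φ).comp continuous_subtype_val).aestronglyMeasurable
    rw [(measurePreserving_sphRot k t).map_eq] at h
    exact h.symm
  have h0 : ∀ x : E3, axisRot k 0 x = x := by
    intro x
    ext j
    rw [axisRot_apply]
    fin_cases k <;> fin_cases j <;> simp [fin3_11, fin3_12, fin3_21, fin3_22]
  simp only [hconst, h0] at hd
  exact hd.unique (hasDerivAt_const _ _)

theorem integral_rot_mul (k : Fin 3) (Φ Ψ : Smooth) :
    ∫ ξ : Sph, (rot k Φ : E3 → ℝ) ξ * (Ψ : E3 → ℝ) ξ ∂surf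
      = -∫ ξ : Sph, (Φ : E3 → ℝ) ξ * (rot k Ψ : E3 → ℝ) ξ ∂surf := by
  have h := integral_rot k (Φ * Ψ)
  have h2 := integral_add (integrable_smooth (rot k Φ * Ψ)) (integrable_smooth (Φ * rot k Ψ))
  simp only [Smooth.mul_apply] at h2
  rw [eq_neg_iff_add_eq_zero, ← h2, ← h]
  congr 1
  funext ξ
  simp [Derivation.leibniz]
  ring

/-- The Dirichlet form of the Beltrami operator. -/
theorem integral_mul_bel (Φ Ψ : Smooth) :
    ∫ ξ : Sph, (Φ : E3 → ℝ) ξ * (bel Ψ : E3 → ℝ) ξ ∂surf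
      = -∫ ξ : Sph, ((∑ i, rot i Φ * rot i Ψ : Smooth) : E3 → ℝ) ξ ∂surf := by
  have h : ∀ i : Fin 3, ∫ ξ : Sph, ((rot i Φ * rot i Ψ : Smooth) : E3 → ℝ) ξ ∂surf
      = -∫ ξ : Sph, ((Φ * rot i (rot i Ψ) : Smooth) : E3 → ℝ) ξ ∂surf :=
    fun i => integral_rot_mul i Φ (rot i Ψ)
  simp only [Smooth.sum_apply]
  rw [integral_finsetSum _ fun i _ => integrable_smooth _, Finset.sum_congr rfl fun i _ => h i,
    Finset.sum_neg_distrib, neg_neg, ← integral_finsetSum _ fun i _ => integrable_smooth _]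
  congr 1
  funext ξ
  simp [bel_apply, Finset.mul_sum]

theorem integral_mul_bel_comm (Φ Ψ : Smooth) :
    ∫ ξ : Sph, (Φ : E3 → ℝ) ξ * (bel Ψ : E3 → ℝ) ξ ∂surf
      = ∫ ξ : Sph, (Ψ : E3 → ℝ) ξ * (bel Φ : E3 → ℝ) ξ ∂surf := by
  rw [integral_mul_bel, integral_mul_bel]
  simp only [mul_comm]

/-- The divergence theorem on the sphere, for tangential fields. -/
theorem integral_sum_tgrad (w : Fin 3 → Smooth) (hw : ∀ ξ : Sph, ⟪(ξ : E3), vec w ξ⟫_ℝ = 0) :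
    ∫ ξ : Sph, ((∑ i, tgrad i (w i) : Smooth) : E3 → ℝ) ξ ∂surf = 0 := by
  have h : ∀ ξ : Sph, ((∑ i, tgrad i (w i) : Smooth) : E3 → ℝ) ξ
      = ∑ k, (rot k (posCross w k) : E3 → ℝ) ξ := by
    intro ξ
    rw [sum_tgrad_eq, Smooth.add_apply, Smooth.mul_apply, ← inner_pos_vec, hw]
    simp
  simp only [h]
  rw [integral_finsetSum _ fun i _ => integrable_smooth _]
  simp [integral_rot]

/-- The surface gradient of a smooth function is its weak surface gradient. -/
theorem integral_inner_tgrad (Φ : Smooth) (φ : E3 → E3) (hφ : ContDiff ℝ ∞ φ)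
    (ht : ∀ ξ : Sph, ⟪(ξ : E3), φ ξ⟫_ℝ = 0) :
    ∫ ξ : Sph, ⟪vec (fun i => tgrad i Φ) ξ, φ ξ⟫_ℝ ∂surf
      = -∫ ξ : Sph, (Φ : E3 → ℝ) ξ * surfaceDiv φ ξ ∂surf := by
  obtain ⟨w, rfl⟩ : ∃ w, φ = vec w := ⟨_, (vec_comps φ hφ).symm⟩
  simp only [surfaceDiv_vec]
  have h := integral_sum_tgrad (fun i => Φ * w i) (fun ξ => by
    have := ht ξ
    rw [inner_eq_sum] at this ⊢
    simp only [vec_apply, Smooth.mul_apply, mul_left_comm _ ((Φ : E3 → ℝ) ξ)] at this ⊢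
    rw [← Finset.mul_sum, this, mul_zero])
  have h2 : ∀ ξ : Sph, ⟪vec (fun i => tgrad i Φ) ξ, vec w ξ⟫_ℝ
      = ((∑ i, tgrad i Φ * w i : Smooth) : E3 → ℝ) ξ := fun ξ => by simp [inner_eq_sum]
  simp only [h2]
  have h3 := integral_add (integrable_smooth (∑ i, tgrad i Φ * w i))
    (integrable_smooth (Φ * ∑ i, tgrad i (w i)))
  simp only [Smooth.mul_apply] at h3
  rw [eq_neg_iff_add_eq_zero, ← h3, ← h]
  congr 1
  funext ξ
  simp [Derivation.leibniz, Finset.sum_add_distrib, Finset.mul_sum]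
  rw [add_comm]
  congr 1
  exact Finset.sum_congr rfl fun i _ => mul_comm _ _

/-! ### Polynomials and spherical harmonics -/

/-- Polynomial functions on three-space of degree at most `n`. -/
noncomputable def Pol (n : ℕ) : Submodule ℝ Smooth :=
  Submodule.span ℝ {m | ∃ a b c : ℕ, a + b + c ≤ n ∧ m = X 0 ^ a * X 1 ^ b * X 2 ^ c}

theorem monomial_mem_pol {a b c n : ℕ} (h : a + b + c ≤ n) :
    X 0 ^ a * X 1 ^ b * X 2 ^ c ∈ Pol n := Submodule.subset_span ⟨a, b, c, h, rfl⟩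

theorem pol_mono : Monotone Pol := fun n m h => by
  refine Submodule.span_mono ?_
  rintro _ ⟨a, b, c, hd, rfl⟩
  exact ⟨a, b, c, hd.trans h, rfl⟩

theorem mul_mem_pol {n m : ℕ} {p q : Smooth} (hp : p ∈ Pol n) (hq : q ∈ Pol m) :
    p * q ∈ Pol (n + m) := by
  have h := Submodule.mul_mem_mul hp hq
  rw [Pol, Pol, Submodule.span_mul_span] at h
  refine Submodule.span_mono ?_ h
  rintro _ ⟨_, ⟨a, b, c, hd, rfl⟩, _, ⟨a', b', c', hd', rfl⟩, rfl⟩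
  exact ⟨a + a', b + b', c + c', by omega, by ring⟩

theorem one_mem_pol (n : ℕ) : (1 : Smooth) ∈ Pol n := by
  simpa using monomial_mem_pol (a := 0) (b := 0) (c := 0) (Nat.zero_le n)

theorem X_mem_pol (i : Fin 3) : X i ∈ Pol 1 := by
  fin_cases i
  · simpa using monomial_mem_pol (a := 1) (b := 0) (c := 0) le_rfl
  · simpa using monomial_mem_pol (a := 0) (b := 1) (c := 0) le_rfl
  · simpa using monomial_mem_pol (a := 0) (b := 0) (c := 1) le_rfl

instance (n : ℕ) : FiniteDimensional ℝ (Pol n) := by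
  refine FiniteDimensional.span_of_finite ℝ ?_
  refine (((Set.finite_Iic n).prod ((Set.finite_Iic n).prod (Set.finite_Iic n))).image
    fun t : ℕ × ℕ × ℕ => X 0 ^ t.1 * X 1 ^ t.2.1 * X 2 ^ t.2.2).subset ?_
  rintro _ ⟨a, b, c, hd, rfl⟩
  refine ⟨(a, b, c), ⟨?_, ?_, ?_⟩, rfl⟩ <;> simp <;> omega

theorem pd_mem_pol (i : Fin 3) {n : ℕ} {p : Smooth} (hp : p ∈ Pol n) : pd i p ∈ Pol (n - 1) := by
  have h : Pol n ≤ (Pol (n - 1)).comap (pd i : Smooth →ₗ[ℝ] Smooth) := by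
    refine Submodule.span_le.2 ?_
    rintro _ ⟨a, b, c, hd, rfl⟩
    change pd i (X 0 ^ a * X 1 ^ b * X 2 ^ c) ∈ Pol (n - 1)
    have h0 : ∀ (k : ℕ) {a b c : ℕ}, (k ≠ 0 → a + b + c ≤ n - 1) →
        k • (X 0 ^ a * X 1 ^ b * X 2 ^ c) ∈ Pol (n - 1) := by
      intro k a b c h
      rcases eq_or_ne k 0 with rfl | hk
      · simp
      · exact nsmul_mem (monomial_mem_pol (h hk)) k
    fin_cases i
    · convert h0 a (a := a - 1) (b := b) (c := c) (by omega) using 1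
      simp [Derivation.leibniz_pow, pd_X]
      ring
    · convert h0 b (a := a) (b := b - 1) (c := c) (by omega) using 1
      simp [Derivation.leibniz_pow, pd_X]
      ring
    · convert h0 c (a := a) (b := b) (c := c - 1) (by omega) using 1
      simp [Derivation.leibniz_pow, pd_X]
      ring
  exact h hp

/-- Euler's relation. -/
theorem euler_monomial (a b c : ℕ) : euler (X 0 ^ a * X 1 ^ b * X 2 ^ c)
    = ((a + b + c : ℕ) : ℝ) • (X 0 ^ a * X 1 ^ b * X 2 ^ c) := by
  have h : ∀ (i : Fin 3) (k : ℕ), euler (X i ^ k) = (k : Smooth) * X i ^ k := by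
    intro i k
    have h1 : euler (X i) = X i := by simp [euler_apply, pd_X]
    cases k with
    | zero => simp
    | succ k =>
      rw [Derivation.leibniz_pow, h1]
      simp [pow_succ]
  rw [Nat.cast_smul_eq_nsmul, nsmul_eq_mul]
  simp only [Derivation.leibniz, h, smul_eq_mul]
  push_cast
  ring

/-- If `m` is homogeneous of degree `d`, then `Δ* m = Δ m - d (d + 1) m` on the sphere. For
`d = n + 1` the zero-order term cancels, for `d ≤ n` it has degree at most `n` anyway. -/
theorem exists_bel_add_eq_of_euler {n d : ℕ} (hd : d ≤ n + 1) {m : Smooth} (hm : m ∈ Pol d)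
    (he : euler m = (d : ℝ) • m) : ∃ r ∈ Pol n, ∀ ξ : Sph,
      (bel m : E3 → ℝ) ξ + (n + 1) * (n + 2) * (m : E3 → ℝ) ξ = (r : E3 → ℝ) ξ := by
  have hlap : lap m ∈ Pol n := by
    rw [lap_apply]
    exact sum_mem fun i _ => pol_mono (by omega) (pd_mem_pol i (pd_mem_pol i hm))
  refine ⟨lap m + (((n : ℝ) + 1) * (n + 2) - d * (d + 1)) • m, add_mem hlap ?_, fun ξ => ?_⟩
  · rcases Nat.lt_or_ge d (n + 1) with h | h
    · exact Submodule.smul_mem _ _ (pol_mono (by omega) hm)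
    · obtain rfl : d = n + 1 := le_antisymm hd h
      have h0 : ((n : ℝ) + 1) * (n + 2) - ((n + 1 : ℕ) : ℝ) * ((n + 1 : ℕ) + 1) = 0 := by
        push_cast
        ring
      rw [h0, zero_smul]
      exact zero_mem _
  · rw [bel_eq, he, Derivation.map_smul, he]
    simp only [Smooth.sub_apply, Smooth.mul_apply, Smooth.smul_apply, Smooth.add_apply,
      normSq_sphere]
    ring

/-- On the sphere, `Δ* + (n + 1) (n + 2)` lowers the degree of polynomials of degree `n + 1`. -/
theorem exists_bel_add_eq {n : ℕ} {p : Smooth} (hp : p ∈ Pol (n + 1)) :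
    ∃ r ∈ Pol n, ∀ ξ : Sph,
      (bel p : E3 → ℝ) ξ + (n + 1) * (n + 2) * (p : E3 → ℝ) ξ = (r : E3 → ℝ) ξ := by
  induction hp using Submodule.span_induction with
  | mem m hm =>
    obtain ⟨a, b, c, hd, rfl⟩ := hm
    exact exists_bel_add_eq_of_euler hd (monomial_mem_pol le_rfl) (euler_monomial a b c)
  | zero => exact ⟨0, zero_mem _, fun ξ => by simp⟩
  | add p q _ _ hp hq =>
    obtain ⟨r, hr, h⟩ := hp
    obtain ⟨s, hs, h'⟩ := hq
    refine ⟨r + s, add_mem hr hs, fun ξ => ?_⟩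
    rw [map_add, Smooth.add_apply, Smooth.add_apply, Smooth.add_apply, ← h, ← h']
    ring
  | smul t p _ hp =>
    obtain ⟨r, hr, h⟩ := hp
    refine ⟨t • r, Submodule.smul_mem _ _ hr, fun ξ => ?_⟩
    rw [map_smul, Smooth.smul_apply, Smooth.smul_apply, Smooth.smul_apply, ← h]
    ring

/-- Polynomials of degree at most `n` whose restrictions to the sphere are spherical harmonics of
degree `n`. -/
noncomputable def Harm (n : ℕ) : Submodule ℝ Smooth where
  carrier := {p | p ∈ Pol n ∧ ∀ ξ : Sph, (bel p : E3 → ℝ) ξ = -(n * (n + 1)) * (p : E3 → ℝ) ξ}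
  zero_mem' := ⟨zero_mem _, fun ξ => by simp⟩
  add_mem' := by
    rintro p q ⟨hp, h⟩ ⟨hq, h'⟩
    refine ⟨add_mem hp hq, fun ξ => ?_⟩
    rw [map_add, Smooth.add_apply, Smooth.add_apply, h, h']
    ring
  smul_mem' := by
    rintro t p ⟨hp, h⟩
    refine ⟨Submodule.smul_mem _ _ hp, fun ξ => ?_⟩
    rw [map_smul, Smooth.smul_apply, Smooth.smul_apply, h]
    ring

theorem bel_harm {n : ℕ} {p : Smooth} (hp : p ∈ Harm n) (ξ : Sph) :
    (bel p : E3 → ℝ) ξ = -(n * (n + 1)) * (p : E3 → ℝ) ξ := hp.2 ξ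

/-- Every polynomial agrees on the sphere with a sum of spherical harmonics. The operator
`Δ* + (n + 1) (n + 2)` sends `p` into degree `n`, where it is invertible on the harmonics of lower
degree; subtracting the preimage leaves a spherical harmonic of degree `n + 1`. -/
theorem exists_harm_sum (n : ℕ) : ∀ p ∈ Pol n, ∃ q : ℕ → Smooth, (∀ k, q k ∈ Harm k) ∧
    ∀ ξ : Sph, (p : E3 → ℝ) ξ = ∑ k ∈ Finset.range (n + 1), (q k : E3 → ℝ) ξ := by
  induction n with
  | zero =>
    intro p hp
    have hpd : ∀ (i : Fin 3), ∀ q ∈ Pol 0, pd i q = 0 := by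
      intro i q hq
      have h : Pol 0 ≤ LinearMap.ker (pd i : Smooth →ₗ[ℝ] Smooth) := by
        refine Submodule.span_le.2 ?_
        rintro _ ⟨a, b, c, hd, rfl⟩
        have h3 : a = 0 ∧ b = 0 ∧ c = 0 := by omega
        obtain ⟨rfl, rfl, rfl⟩ := h3
        simp
      exact h hq
    refine ⟨fun k => if k = 0 then p else 0, fun k => ?_, fun ξ => by simp⟩
    rcases eq_or_ne k 0 with rfl | hk
    · simp only [if_true]
      refine ⟨hp, fun ξ => ?_⟩
      simp [bel_apply, rot_apply, hpd _ p hp]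
    · simp only [if_neg hk]
      exact zero_mem _
  | succ n ih =>
    intro p hp
    obtain ⟨r, hr, hpr⟩ := exists_bel_add_eq hp
    obtain ⟨q, hq, hrq⟩ := ih r hr
    set t : ℕ → ℝ := fun k => ((n + 1) * (n + 2) - k * (k + 1))⁻¹ with ht
    have htk : ∀ k ∈ Finset.range (n + 1), t k * ((n + 1) * (n + 2) - k * (k + 1)) = 1 := by
      intro k hk
      have hk' : (k : ℝ) ≤ n := by exact_mod_cast Nat.lt_succ_iff.1 (Finset.mem_range.1 hk)
      have hk0 : (0 : ℝ) ≤ k := k.cast_nonneg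
      refine inv_mul_cancel₀ (ne_of_gt ?_)
      nlinarith
    set p' : Smooth := ∑ k ∈ Finset.range (n + 1), t k • q k with hp'
    have hp'mem : p' ∈ Pol (n + 1) := sum_mem fun k hk => Submodule.smul_mem _ _
      (pol_mono (by have := Finset.mem_range.1 hk; omega) (hq k).1)
    have hbel : ∀ ξ : Sph, (bel p' : E3 → ℝ) ξ + (n + 1) * (n + 2) * (p' : E3 → ℝ) ξ
        = (r : E3 → ℝ) ξ := by
      intro ξ
      rw [hrq, hp', map_sum, Smooth.sum_apply, Smooth.sum_apply, Finset.mul_sum,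
        ← Finset.sum_add_distrib]
      refine Finset.sum_congr rfl fun k hk => ?_
      rw [map_smul, Smooth.smul_apply, Smooth.smul_apply, bel_harm (hq k)]
      linear_combination (q k : E3 → ℝ) ξ * htk k hk
    refine ⟨fun k => if k = n + 1 then p - p' else t k • q k, fun k => ?_, fun ξ => ?_⟩
    · rcases eq_or_ne k (n + 1) with rfl | hk
      · simp only [if_true]
        refine ⟨sub_mem hp hp'mem, fun ξ => ?_⟩
        rw [map_sub, Smooth.sub_apply, Smooth.sub_apply]
        push_cast
        linear_combination hpr ξ - hbel ξ
      · simp only [if_neg hk]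
        exact Submodule.smul_mem _ _ (hq k)
    · rw [Finset.sum_range_succ]
      have h1 : ∀ k ∈ Finset.range (n + 1),
          ((if k = n + 1 then p - p' else t k • q k : Smooth) : E3 → ℝ) ξ
            = ((t k • q k : Smooth) : E3 → ℝ) ξ := fun k hk => by
        rw [if_neg (Finset.mem_range.1 hk).ne]
      rw [Finset.sum_congr rfl h1]
      beta_reduce
      rw [if_pos rfl, Smooth.sub_apply, hp', Smooth.sum_apply]
      ring

/-! ### Density in `L²` -/

/-- The restriction of a smooth function to the sphere. -/
noncomputable def restr : Smooth →ₐ[ℝ] C(Sph, ℝ) where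
  toFun Φ := ⟨fun ξ => (Φ : E3 → ℝ) ξ, (Smooth.continuous Φ).comp continuous_subtype_val⟩
  map_one' := rfl
  map_mul' _ _ := rfl
  map_zero' := rfl
  map_add' _ _ := rfl
  commutes' _ := rfl

/-- The class in `L²` of the restriction of a smooth function to the sphere. -/
noncomputable def sm : Smooth →ₗ[ℝ] ScalarL2 :=
  (ContinuousMap.toLp 2 surf ℝ : C(Sph, ℝ) →L[ℝ] ScalarL2).toLinearMap ∘ₗ restr.toLinearMap

theorem coeFn_sm (Φ : Smooth) : sm Φ =ᵐ[surf] fun ξ : Sph => (Φ : E3 → ℝ) ξ :=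
  ContinuousMap.coeFn_toLp surf (restr Φ)

theorem sm_eq_iff {Φ Ψ : Smooth} :
    sm Φ = sm Ψ ↔ ∀ ξ : Sph, (Φ : E3 → ℝ) ξ = (Ψ : E3 → ℝ) ξ := by
  constructor
  · intro h ξ
    exact DFunLike.congr_fun (ContinuousMap.toLp_injective (p := 2) (𝕜 := ℝ) surf h) ξ
  · intro h
    have : restr Φ = restr Ψ := ContinuousMap.ext h
    change ContinuousMap.toLp 2 surf ℝ (restr Φ) = ContinuousMap.toLp 2 surf ℝ (restr Ψ)
    rw [this]

theorem inner_sm_right (F : ScalarL2) (Φ : Smooth) :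
    ⟪F, sm Φ⟫_ℝ = ∫ ξ : Sph, F ξ * (Φ : E3 → ℝ) ξ ∂surf := by
  rw [L2.inner_def]
  refine integral_congr_ae ?_
  filter_upwards [coeFn_sm Φ] with ξ h
  rw [h]
  exact mul_comm _ _

theorem inner_sm_sm (Φ Ψ : Smooth) :
    ⟪sm Φ, sm Ψ⟫_ℝ = ∫ ξ : Sph, (Φ : E3 → ℝ) ξ * (Ψ : E3 → ℝ) ξ ∂surf := by
  rw [inner_sm_right]
  refine integral_congr_ae ?_
  filter_upwards [coeFn_sm Φ] with ξ h
  rw [h]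

theorem inner_sm_bel (Φ Ψ : Smooth) : ⟪sm Φ, sm (bel Ψ)⟫_ℝ = ⟪sm (bel Φ), sm Ψ⟫_ℝ := by
  rw [inner_sm_sm, inner_sm_sm, integral_mul_bel_comm]
  simp only [mul_comm]

theorem sm_bel_harm {n : ℕ} {p : Smooth} (hp : p ∈ Harm n) :
    sm (bel p) = (-(n * (n + 1)) : ℝ) • sm p := by
  rw [← map_smul, sm_eq_iff]
  exact bel_harm hp

/-- The space of spherical harmonics of degree `n`, as a subspace of `L²(Ω)`. -/
noncomputable def HarmL2 (n : ℕ) : Submodule ℝ ScalarL2 := (Harm n).map sm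

instance (n : ℕ) : FiniteDimensional ℝ (HarmL2 n) := by
  have h : HarmL2 n ≤ (Pol n).map sm := Submodule.map_mono fun p hp => hp.1
  exact Submodule.finiteDimensional_of_le h

theorem sm_mem_iSup_harmL2 {n : ℕ} {p : Smooth} (hp : p ∈ Pol n) : sm p ∈ ⨆ n, HarmL2 n := by
  obtain ⟨q, hq, h⟩ := exists_harm_sum n p hp
  have : sm p = ∑ k ∈ Finset.range (n + 1), sm (q k) := by
    rw [← map_sum, sm_eq_iff]
    intro ξ
    rw [h, Smooth.sum_apply]
  rw [this]
  exact sum_mem fun k _ => Submodule.mem_iSup_of_mem k ⟨_, hq k, rfl⟩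

/-- Completeness of the spherical harmonics, by the Stone-Weierstrass theorem. -/
theorem harmL2_dense : ⊤ ≤ (⨆ n, HarmL2 n).topologicalClosure := by
  set A : Subalgebra ℝ C(Sph, ℝ) := Algebra.adjoin ℝ (Set.range fun i => restr (X i)) with hA
  have hsep : A.SeparatesPoints := by
    intro ξ η hne
    have : ∃ i, (ξ : E3) i ≠ (η : E3) i := by
      by_contra! h
      exact hne (Subtype.ext (by ext i; exact h i))
    obtain ⟨i, hi⟩ := this
    exact ⟨_, ⟨restr (X i), Algebra.subset_adjoin ⟨i, rfl⟩, rfl⟩, hi⟩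
  have hpoly : ∀ g ∈ A, ∃ n, ∃ p ∈ Pol n, restr p = g := by
    intro g hg
    induction hg using Algebra.adjoin_induction with
    | mem g hg =>
      obtain ⟨i, rfl⟩ := hg
      exact ⟨1, X i, X_mem_pol i, rfl⟩
    | algebraMap r =>
      exact ⟨0, algebraMap ℝ Smooth r, by
        rw [Algebra.algebraMap_eq_smul_one]
        exact Submodule.smul_mem _ _ (one_mem_pol 0), rfl⟩
    | add g h _ _ hg hh =>
      obtain ⟨n, p, hp, rfl⟩ := hg
      obtain ⟨m, q, hq, rfl⟩ := hh
      exact ⟨max n m, p + q, add_mem (pol_mono (le_max_left _ _) hp)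
        (pol_mono (le_max_right _ _) hq), map_add _ _ _⟩
    | mul g h _ _ hg hh =>
      obtain ⟨n, p, hp, rfl⟩ := hg
      obtain ⟨m, q, hq, rfl⟩ := hh
      exact ⟨n + m, p * q, mul_mem_pol hp hq, map_mul _ _ _⟩
  have htop : (Subalgebra.toSubmodule A).topologicalClosure = ⊤ := by
    have := ContinuousMap.subalgebra_topologicalClosure_eq_top_of_separatesPoints A hsep
    rw [Submodule.eq_top_iff']
    intro g
    have hg : g ∈ A.topologicalClosure := by rw [this]; trivial
    exact hg
  have h := (ContinuousMap.toLp_denseRange (p := 2) ℝ surf ℝ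
    (by simp)).topologicalClosure_map_submodule htop
  rw [← h]
  refine Submodule.topologicalClosure_mono ?_
  rintro _ ⟨g, hg, rfl⟩
  obtain ⟨n, p, hp, rfl⟩ := hpoly g hg
  exact sm_mem_iSup_harmL2 hp

/-- Symmetry of the Beltrami operator makes its eigenspaces orthogonal. -/
theorem orthogonal_harm {n m : ℕ} (hnm : n ≠ m) {p q : Smooth} (hp : p ∈ Harm n)
    (hq : q ∈ Harm m) : ⟪sm p, sm q⟫_ℝ = 0 := by
  have h := inner_sm_bel p q
  rw [sm_bel_harm hp, sm_bel_harm hq, inner_smul_left, inner_smul_right] at h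
  simp only [conj_trivial] at h
  have h0 : ((n : ℝ) - m) * (n + m + 1) ≠ 0 := by
    refine mul_ne_zero (sub_ne_zero.2 (by exact_mod_cast hnm)) ?_
    positivity
  refine (mul_eq_zero.1 (?_ : ((n : ℝ) - m) * (n + m + 1) * ⟪sm p, sm q⟫_ℝ = 0)).resolve_left h0
  linear_combination h

theorem orthogonalFamily_harmL2 :
    OrthogonalFamily ℝ (fun n => HarmL2 n) fun n => (HarmL2 n).subtypeₗᵢ := by
  rintro n m hnm ⟨_, p, hp, rfl⟩ ⟨_, q, hq, rfl⟩
  exact orthogonal_harm hnm hp hq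

theorem isHilbertSum_harmL2 : IsHilbertSum ℝ (fun n => HarmL2 n) fun n => (HarmL2 n).subtypeₗᵢ :=
  IsHilbertSum.mkInternal HarmL2 orthogonalFamily_harmL2 harmL2_dense

/-! ### Expansion in spherical harmonics -/

/-- The orthogonal projection onto the spherical harmonics of degree `n`. -/
noncomputable def proj (n : ℕ) : ScalarL2 →L[ℝ] ScalarL2 := (HarmL2 n).starProjection

theorem proj_mem (n : ℕ) (F : ScalarL2) : proj n F ∈ HarmL2 n :=
  Submodule.starProjection_apply_mem _ _

theorem exists_harm_proj (n : ℕ) (F : ScalarL2) : ∃ q ∈ Harm n, sm q = proj n F := proj_mem n F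

theorem proj_of_mem {n : ℕ} {F : ScalarL2} (h : F ∈ HarmL2 n) : proj n F = F :=
  Submodule.starProjection_eq_self_iff.2 h

theorem proj_of_mem_ne {n m : ℕ} (hnm : n ≠ m) {F : ScalarL2} (h : F ∈ HarmL2 m) :
    proj n F = 0 := by
  refine (Submodule.starProjection_apply_eq_zero_iff _).2 fun G hG => ?_
  exact orthogonalFamily_harmL2 hnm ⟨G, hG⟩ ⟨F, h⟩

theorem proj_eq_zero_iff {n : ℕ} {F : ScalarL2} :
    proj n F = 0 ↔ ∀ q ∈ Harm n, ⟪F, sm q⟫_ℝ = 0 := by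
  rw [proj, Submodule.starProjection_apply_eq_zero_iff, Submodule.mem_orthogonal']
  constructor
  · exact fun h q hq => h _ ⟨q, hq, rfl⟩
  · rintro h _ ⟨q, hq, rfl⟩
    exact h q hq

theorem inner_proj_harm {n : ℕ} {q : Smooth} (hq : q ∈ Harm n) (F : ScalarL2) :
    ⟪proj n F, sm q⟫_ℝ = ⟪F, sm q⟫_ℝ := by
  rw [proj, Submodule.inner_starProjection_left_eq_right]
  congr 1
  exact proj_of_mem ⟨q, hq, rfl⟩

theorem inner_proj_self (n : ℕ) (F : ScalarL2) : ⟪F, proj n F⟫_ℝ = ‖proj n F‖ ^ 2 := by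
  rw [← real_inner_self_eq_norm_sq]
  obtain ⟨q, hq, h⟩ := exists_harm_proj n F
  rw [← h, ← inner_proj_harm hq, h]

theorem proj_eq_of_hasSum {u : ℕ → ScalarL2} (hu : ∀ n, u n ∈ HarmL2 n) {F : ScalarL2}
    (h : HasSum u F) (n : ℕ) : proj n F = u n := by
  have h1 := h.mapL (proj n)
  have h2 : HasSum (fun m => proj n (u m)) (proj n (u n)) :=
    hasSum_single n fun m hm => proj_of_mem_ne hm.symm (hu m)
  rw [h1.unique h2, proj_of_mem (hu n)]

theorem hasSum_proj (F : ScalarL2) : HasSum (fun n => proj n F) F := by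
  have h := isHilbertSum_harmL2.hasSum_linearIsometryEquiv_symm
    (isHilbertSum_harmL2.linearIsometryEquiv F)
  rw [LinearIsometryEquiv.symm_apply_apply] at h
  have h2 := proj_eq_of_hasSum (fun n => (isHilbertSum_harmL2.linearIsometryEquiv F n).2) h
  convert h using 1
  funext n
  exact h2 n

theorem ext_proj {F G : ScalarL2} (h : ∀ n, proj n F = proj n G) : F = G :=
  (hasSum_proj F).unique ((funext h : (fun n => proj n F) = _) ▸ hasSum_proj G)

theorem hasSum_norm_sq_proj (F : ScalarL2) : HasSum (fun n => ‖proj n F‖ ^ 2) (‖F‖ ^ 2) := by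
  have h := (hasSum_proj F).mapL (innerSL ℝ F)
  simpa only [innerSL_apply_apply, inner_proj_self, real_inner_self_eq_norm_sq] using h

theorem exists_proj_eq {u : ℕ → ScalarL2} (hu : ∀ n, u n ∈ HarmL2 n)
    (h : Summable fun n => ‖u n‖ ^ 2) : ∃ G, ∀ n, proj n G = u n := by
  have h1 : Summable u :=
    (orthogonalFamily_harmL2.summable_iff_norm_sq_summable fun n => ⟨u n, hu n⟩).2 h
  exact ⟨_, proj_eq_of_hasSum hu h1.hasSum⟩

/-- A multiplier `c` acts on those `F` for which the products are square-summable. -/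
theorem exists_proj_eq_smul (c : ℕ → ℝ) (F : ScalarL2)
    (h : Summable fun n => c n ^ 2 * ‖proj n F‖ ^ 2) : ∃ G, ∀ n, proj n G = c n • proj n F := by
  refine exists_proj_eq (fun n => Submodule.smul_mem _ _ (proj_mem n F)) ?_
  simpa only [norm_smul, mul_pow, Real.norm_eq_abs, sq_abs] using h

theorem exists_proj_eq_smul_of_bdd (c : ℕ → ℝ) (C : ℝ) (hc : ∀ n, c n ^ 2 ≤ C) (F : ScalarL2) :
    ∃ G, ∀ n, proj n G = c n • proj n F :=
  exists_proj_eq_smul c F (Summable.of_nonneg_of_le (fun n => by positivity)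
    (fun n => mul_le_mul_of_nonneg_right (hc n) (by positivity))
    ((hasSum_norm_sq_proj F).summable.mul_left C))

theorem one_mem_harm : (1 : Smooth) ∈ Harm 0 :=
  ⟨one_mem_pol 0, fun ξ => by simp [bel_apply]⟩

theorem pol_zero_le : Pol 0 ≤ Submodule.span ℝ {(1 : Smooth)} := by
  refine Submodule.span_le.2 ?_
  rintro _ ⟨a, b, c, hd, rfl⟩
  have h3 : a = 0 ∧ b = 0 ∧ c = 0 := by omega
  obtain ⟨rfl, rfl, rfl⟩ := h3
  simp

theorem inner_sm_one (F : ScalarL2) : ⟪F, sm 1⟫_ℝ = ∫ ξ, F ξ ∂surf := by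
  rw [inner_sm_right]
  simp

/-- The component of degree zero vanishes exactly for the functions with mean zero. -/
theorem proj_zero_eq_zero_iff {F : ScalarL2} : proj 0 F = 0 ↔ ∫ ξ, F ξ ∂surf = 0 := by
  rw [proj_eq_zero_iff, ← inner_sm_one]
  refine ⟨fun h => h 1 one_mem_harm, fun h q hq => ?_⟩
  obtain ⟨c, rfl⟩ := Submodule.mem_span_singleton.1 (pol_zero_le hq.1)
  rw [map_smul, inner_smul_right, h, mul_zero]

theorem exists_proj_zero_eq (F : ScalarL2) : ∃ c : ℝ, proj 0 F = c • sm 1 := by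
  obtain ⟨q, hq, h⟩ := exists_harm_proj 0 F
  obtain ⟨c, rfl⟩ := Submodule.mem_span_singleton.1 (pol_zero_le hq.1)
  exact ⟨c, by rw [← h, map_smul]⟩

/-! ### The operator `D` -/

theorem sqrt_eigenvalue (n : ℕ) : √((n : ℝ) * (n + 1) + 1 / 4) = n + 1 / 2 := by
  rw [show (n : ℝ) * (n + 1) + 1 / 4 = (n + 1 / 2) ^ 2 by ring]
  exact Real.sqrt_sq (by positivity)

/-- `D` multiplies the component of degree `n` by `n + 1/2`. -/
theorem isD_iff {F G : ScalarL2} :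
    IsD F G ↔ ∀ n : ℕ, proj n G = ((n : ℝ) + 1 / 2) • proj n F := by
  constructor
  · intro h n
    rw [← sub_eq_zero, ← map_smul, ← map_sub, proj_eq_zero_iff]
    intro q hq
    have h1 := h (n * (n + 1)) q (Smooth.contDiff q) fun ξ => by
      rw [beltrami_apply, bel_harm hq]
      ring
    rw [← inner_sm_right, ← inner_sm_right, sqrt_eigenvalue] at h1
    rw [inner_sub_left, inner_smul_left, h1, conj_trivial, sub_self]
  · intro h l Y hY hl
    obtain ⟨Φ, rfl⟩ : ∃ Φ : Smooth, (Φ : E3 → ℝ) = Y := ⟨⟨Y, hY⟩, rfl⟩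
    have hbel : sm (bel Φ) = (-l) • sm Φ := by
      rw [← map_smul, sm_eq_iff]
      intro ξ
      rw [Smooth.smul_apply, ← beltrami_apply]
      linear_combination -hl ξ
    rw [← inner_sm_right, ← inner_sm_right]
    have h1 : ∀ F : ScalarL2, HasSum (fun n => ⟪sm Φ, proj n F⟫_ℝ) ⟪sm Φ, F⟫_ℝ := fun F =>
      (hasSum_proj F).mapL (innerSL ℝ (sm Φ))
    rw [real_inner_comm, real_inner_comm _ F]
    suffices h2 : ∀ n, ⟪sm Φ, proj n G⟫_ℝ = √(l + 1 / 4) * ⟪sm Φ, proj n F⟫_ℝ by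
      have h3 := h1 G
      simp only [h2] at h3
      exact h3.unique ((h1 F).mul_left _)
    intro n
    rw [h n, inner_smul_right]
    -- either the eigenvalue is `n (n + 1)`, or the eigenfunction has no component of degree `n`
    rcases eq_or_ne l (n * (n + 1)) with rfl | hne
    · rw [sqrt_eigenvalue]
    · obtain ⟨q, hq, hqF⟩ := exists_harm_proj n F
      have h2 := inner_sm_bel Φ q
      rw [sm_bel_harm hq, hbel, inner_smul_left, inner_smul_right, conj_trivial] at h2
      have h3 : ⟪sm Φ, sm q⟫_ℝ = 0 := by
        refine (mul_eq_zero.1 (?_ : (l - n * (n + 1)) * _ = 0)).resolve_left (sub_ne_zero.2 hne)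
        linear_combination h2
      rw [← hqF, h3, mul_zero, mul_zero]

theorem isDInv_iff {F G : ScalarL2} :
    IsDInv F G ↔ ∀ n : ℕ, proj n F = ((n : ℝ) + 1 / 2) • proj n G := isD_iff

theorem isDAddHalfInv_iff {F G : ScalarL2} :
    IsDAddHalfInv F G ↔ ∀ n : ℕ, proj n F = ((n : ℝ) + 1) • proj n G := by
  rw [IsDAddHalfInv, isD_iff]
  refine forall_congr' fun n => ?_
  rw [map_sub, map_smul, sub_eq_iff_eq_add, ← add_smul]
  norm_num [add_assoc]

/-- In degree zero the equation reads `0 = 0 • 0`: the inverse is taken between functions with mean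
zero. -/
theorem isDSubHalfInv_iff {F G : ScalarL2} :
    IsDSubHalfInv F G ↔ proj 0 G = 0 ∧ ∀ n : ℕ, proj n F = (n : ℝ) • proj n G := by
  rw [IsDSubHalfInv, isD_iff, ← proj_zero_eq_zero_iff, ← proj_zero_eq_zero_iff]
  have h : ∀ n : ℕ, proj n (F + (1 / 2 : ℝ) • G) = ((n : ℝ) + 1 / 2) • proj n G ↔
      proj n F = (n : ℝ) • proj n G := fun n => by
    rw [map_add, map_smul, add_smul, add_left_inj]
  simp only [h]
  exact ⟨fun h => h.2, fun h => ⟨by rw [h.2 0, Nat.cast_zero, zero_smul], h⟩⟩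

/-! ### Square-integrable vector fields -/

/-- The class in `L²` of the restriction of a smooth vector field to the sphere. -/
noncomputable def vm : (Fin 3 → Smooth) →ₗ[ℝ] VectorL2 where
  toFun w := ContinuousMap.toLp 2 surf ℝ
    (⟨fun ξ : Sph => vec w ξ, (contDiff_vec w).continuous.comp continuous_subtype_val⟩ : C(Sph, E3))
  map_add' v w := (ContinuousMap.toLp 2 surf ℝ).map_add ⟨fun ξ : Sph => vec v ξ, _⟩
    ⟨fun ξ : Sph => vec w ξ, _⟩
  map_smul' c w := (ContinuousMap.toLp 2 surf ℝ).map_smul c ⟨fun ξ : Sph => vec w ξ, _⟩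

theorem coeFn_vm (w : Fin 3 → Smooth) : vm w =ᵐ[surf] fun ξ : Sph => vec w ξ :=
  ContinuousMap.coeFn_toLp surf _

theorem inner_vm_right (g : VectorL2) (w : Fin 3 → Smooth) :
    ⟪g, vm w⟫_ℝ = ∫ ξ : Sph, ⟪g ξ, vec w ξ⟫_ℝ ∂surf := by
  rw [L2.inner_def]
  refine integral_congr_ae ?_
  filter_upwards [coeFn_vm w] with ξ h
  rw [h]

theorem inner_vm_vm (v w : Fin 3 → Smooth) :
    ⟪vm v, vm w⟫_ℝ = ∫ ξ : Sph, ((∑ i, v i * w i : Smooth) : E3 → ℝ) ξ ∂surf := by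
  rw [inner_vm_right]
  refine integral_congr_ae ?_
  filter_upwards [coeFn_vm v] with ξ h
  rw [h, inner_eq_sum]
  simp

theorem vm_congr {v w : Fin 3 → Smooth}
    (h : ∀ (ξ : Sph) (i : Fin 3), (v i : E3 → ℝ) ξ = (w i : E3 → ℝ) ξ) : vm v = vm w := by
  refine Lp.ext ?_
  filter_upwards [coeFn_vm v, coeFn_vm w] with ξ h1 h2
  rw [h1, h2]
  ext i
  exact h ξ i

theorem norm_sphere (ξ : Sph) : ‖(ξ : E3)‖ = 1 := by simp

/-- `o⁽¹⁾` as a linear isometry. -/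
noncomputable def o1L : ScalarL2 →ₗᵢ[ℝ] VectorL2 where
  toFun := o1
  map_add' F G := by
    refine Lp.ext ?_
    filter_upwards [(memLp_normal (F + G)).coeFn_toLp, (memLp_normal F).coeFn_toLp,
      (memLp_normal G).coeFn_toLp, Lp.coeFn_add (o1 F) (o1 G), Lp.coeFn_add F G]
      with ξ h1 h2 h3 h4 h5
    rw [h4, Pi.add_apply, o1, o1, o1, h1, h2, h3, h5, Pi.add_apply, add_smul]
  map_smul' c F := by
    refine Lp.ext ?_
    filter_upwards [(memLp_normal (c • F)).coeFn_toLp, (memLp_normal F).coeFn_toLp,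
      Lp.coeFn_smul c (o1 F), Lp.coeFn_smul c F] with ξ h1 h2 h3 h4
    rw [RingHom.id_apply, h3, Pi.smul_apply, o1, o1, h1, h2, h4, Pi.smul_apply, smul_assoc]
  norm_map' F := by
    change ‖o1 F‖ = ‖F‖
    have h : ‖o1 F‖ ≤ ‖F‖ ∧ ‖F‖ ≤ ‖o1 F‖ := by
      constructor <;> refine Lp.norm_le_norm_of_ae_le ?_ <;>
        filter_upwards [(memLp_normal F).coeFn_toLp] with ξ h1 <;>
        rw [o1, h1, norm_smul, norm_sphere, mul_one]
    exact le_antisymm h.1 h.2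

theorem coeFn_o1 (F : ScalarL2) : o1 F =ᵐ[surf] fun ξ : Sph => F ξ • (ξ : E3) :=
  (memLp_normal F).coeFn_toLp

/-- The normal component of a vector field, as the adjoint of `o⁽¹⁾`. -/
noncomputable def nrm : VectorL2 →L[ℝ] ScalarL2 :=
  ContinuousLinearMap.adjoint o1L.toContinuousLinearMap

theorem inner_nrm (F : ScalarL2) (g : VectorL2) : ⟪F, nrm g⟫_ℝ = ⟪o1 F, g⟫_ℝ :=
  ContinuousLinearMap.adjoint_inner_right _ _ _

theorem coeFn_nrm (g : VectorL2) : nrm g =ᵐ[surf] fun ξ : Sph => ⟪(ξ : E3), g ξ⟫_ℝ := by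
  have hmem : MemLp (fun ξ : Sph => ⟪(ξ : E3), g ξ⟫_ℝ) 2 surf := by
    refine (Lp.memLp g).of_le
      (continuous_subtype_val.aestronglyMeasurable.inner (Lp.aestronglyMeasurable g)) ?_
    refine Filter.Eventually.of_forall fun ξ => ?_
    have := norm_inner_le_norm (𝕜 := ℝ) (ξ : E3) (g ξ)
    rwa [norm_sphere, one_mul] at this
  have h : nrm g = hmem.toLp _ := by
    refine ext_inner_left ℝ fun F => ?_
    rw [inner_nrm, L2.inner_def, L2.inner_def]
    refine integral_congr_ae ?_
    filter_upwards [coeFn_o1 F, hmem.coeFn_toLp] with ξ h1 h2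
    rw [h1, h2, inner_smul_left]
    exact mul_comm _ _
  rw [h]
  exact hmem.coeFn_toLp

theorem nrm_o1 (F : ScalarL2) : nrm (o1 F) = F := by
  refine ext_inner_left ℝ fun G => ?_
  rw [inner_nrm]
  exact o1L.inner_map_map G F

theorem nrm_eq_zero_iff {g : VectorL2} :
    nrm g = 0 ↔ ∀ᵐ ξ : Sph ∂surf, ⟪(ξ : E3), g ξ⟫_ℝ = 0 := by
  rw [Lp.eq_zero_iff_ae_eq_zero]
  constructor
  · intro h
    filter_upwards [h, coeFn_nrm g] with ξ h1 h2
    rw [← h2, h1, Pi.zero_apply]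
  · intro h
    filter_upwards [h, coeFn_nrm g] with ξ h1 h2
    rw [h2, h1, Pi.zero_apply]

theorem nrm_vm {w : Fin 3 → Smooth} (hw : ∑ i, X i * w i = 0) : nrm (vm w) = 0 := by
  rw [nrm_eq_zero_iff]
  filter_upwards [coeFn_vm w] with ξ h
  rw [h, inner_pos_vec, hw, Smooth.zero_apply]

theorem cross_add (x y z : E3) : cross x (y + z) = cross x y + cross x z := by
  ext i
  simp only [cross_apply, PiLp.add_apply]
  ring

theorem cross_smul (x y : E3) (c : ℝ) : cross x (c • y) = c • cross x y := by
  ext i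
  simp only [cross_apply, PiLp.smul_apply, smul_eq_mul]
  ring

/-- Multiplication by a vector in the vector product is skew-adjoint. -/
theorem inner_cross (x y z : E3) : ⟪cross x y, z⟫_ℝ = -⟪y, cross x z⟫_ℝ := by
  simp only [inner_eq_sum, cross_apply, Fin.sum_univ_three, fin3_11, fin3_12, fin3_21, fin3_22,
    zero_add]
  ring

theorem inner_pos_cross (x y : E3) : ⟪x, cross x y⟫_ℝ = 0 := by
  simp only [inner_eq_sum, cross_apply, Fin.sum_univ_three, fin3_11, fin3_12, fin3_21, fin3_22,
    zero_add]
  ring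

theorem cross_cross_self (x y : E3) : cross x (cross x y) = ⟪x, y⟫_ℝ • x - ‖x‖ ^ 2 • y := by
  rw [EuclideanSpace.real_norm_sq_eq]
  ext i
  fin_cases i <;>
  · simp [inner_eq_sum, cross_apply, Fin.sum_univ_three, fin3_11, fin3_12, fin3_21, fin3_22]
    ring

theorem norm_cross_le (ξ : Sph) (y : E3) : ‖cross (ξ : E3) y‖ ≤ ‖y‖ := by
  rw [← sq_le_sq₀ (norm_nonneg _) (norm_nonneg _), ← real_inner_self_eq_norm_sq, inner_cross,
    cross_cross_self, inner_sub_right, inner_smul_right, inner_smul_right, norm_sphere,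
    real_inner_self_eq_norm_sq, real_inner_comm]
  nlinarith [sq_nonneg ⟪(y : E3), (ξ : E3)⟫_ℝ]

theorem continuous_cross (x : E3 × E3) : ContinuousAt (fun x : E3 × E3 => cross x.1 x.2) x := by
  refine Continuous.continuousAt ?_
  refine (PiLp.continuous_toLp 2 _).comp (continuous_pi fun i => ?_)
  have h : ∀ x : E3 × E3, crossProduct x.1.ofLp x.2.ofLp i
      = x.1 (i + 1) * x.2 (i + 2) - x.1 (i + 2) * x.2 (i + 1) := fun x => cross_apply x.1 x.2 i
  simp only [h]
  fun_prop

theorem memLp_cross (g : VectorL2) : MemLp (fun ξ : Sph => cross (ξ : E3) (g ξ)) 2 surf := by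
  refine (Lp.memLp g).of_le ?_ (Filter.Eventually.of_forall fun ξ => norm_cross_le ξ (g ξ))
  exact (continuous_iff_continuousAt.2 continuous_cross).comp_aestronglyMeasurable
    (continuous_subtype_val.aestronglyMeasurable.prodMk (Lp.aestronglyMeasurable g))

/-- The operator `g ↦ ξ ∧ g` on square-integrable vector fields. -/
noncomputable def crossL : VectorL2 →L[ℝ] VectorL2 :=
  LinearMap.mkContinuous
    { toFun := fun g => (memLp_cross g).toLp _
      map_add' := fun g h => by
        rw [← MemLp.toLp_add]
        refine (MemLp.toLp_eq_toLp_iff _ _).2 ?_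
        filter_upwards [Lp.coeFn_add g h] with ξ h1
        rw [h1, Pi.add_apply, cross_add, Pi.add_apply]
      map_smul' := fun c g => by
        rw [RingHom.id_apply, ← MemLp.toLp_const_smul]
        refine (MemLp.toLp_eq_toLp_iff _ _).2 ?_
        filter_upwards [Lp.coeFn_smul c g] with ξ h1
        rw [h1, Pi.smul_apply, cross_smul, Pi.smul_apply] } 1 fun g => by
    rw [one_mul]
    refine Lp.norm_le_norm_of_ae_le ?_
    filter_upwards [(memLp_cross g).coeFn_toLp] with ξ h
    change ‖(memLp_cross g).toLp _ ξ‖ ≤ _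
    rw [h]
    exact norm_cross_le ξ (g ξ)

theorem coeFn_crossL (g : VectorL2) : crossL g =ᵐ[surf] fun ξ : Sph => cross (ξ : E3) (g ξ) :=
  (memLp_cross g).coeFn_toLp

theorem inner_crossL (g h : VectorL2) : ⟪crossL g, h⟫_ℝ = -⟪g, crossL h⟫_ℝ := by
  rw [L2.inner_def, L2.inner_def, ← integral_neg]
  refine integral_congr_ae ?_
  filter_upwards [coeFn_crossL g, coeFn_crossL h] with ξ h1 h2
  rw [h1, h2, inner_cross]

theorem crossL_vm (w : Fin 3 → Smooth) : crossL (vm w) = vm (posCross w) := by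
  refine Lp.ext ?_
  filter_upwards [coeFn_crossL (vm w), coeFn_vm w, coeFn_vm (posCross w)] with ξ h1 h2 h3
  rw [h1, h2, h3, cross_vec]

theorem nrm_crossL (g : VectorL2) : nrm (crossL g) = 0 := by
  rw [nrm_eq_zero_iff]
  filter_upwards [coeFn_crossL g] with ξ h
  rw [h, inner_pos_cross]

theorem crossL_crossL {g : VectorL2} (hg : nrm g = 0) : crossL (crossL g) = -g := by
  rw [nrm_eq_zero_iff] at hg
  refine Lp.ext ?_
  filter_upwards [hg, coeFn_crossL (crossL g), coeFn_crossL g, Lp.coeFn_neg g] with ξ h1 h2 h3 h4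
  rw [h2, h3, h4, cross_cross_self, h1, norm_sphere]
  simp

/-! ### Weak surface gradients -/

/-- The surface gradient of a smooth function, by components. -/
noncomputable def gradF (Φ : Smooth) : Fin 3 → Smooth := fun i => tgrad i Φ

/-- The surface curl gradient of a smooth function, by components. -/
noncomputable def curlF (Φ : Smooth) : Fin 3 → Smooth := fun i => rot i Φ

theorem nrm_vm_gradF (Φ : Smooth) : nrm (vm (gradF Φ)) = 0 := nrm_vm (sum_X_mul_tgrad Φ)

theorem nrm_vm_curlF (Φ : Smooth) : nrm (vm (curlF Φ)) = 0 := nrm_vm (sum_X_mul_rot Φ)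

theorem crossL_gradF (Φ : Smooth) : crossL (vm (gradF Φ)) = vm (curlF Φ) := by
  rw [crossL_vm]
  refine vm_congr fun ξ i => ?_
  change (posCross (fun i => tgrad i Φ) i : E3 → ℝ) ξ = (rot i Φ : E3 → ℝ) ξ
  rw [posCross_tgrad, Smooth.mul_apply, normSq_sphere, one_mul]

theorem crossL_curlF (Φ : Smooth) : crossL (vm (curlF Φ)) = -vm (gradF Φ) := by
  rw [← crossL_gradF, crossL_crossL (nrm_vm_gradF Φ)]

/-- The weak surface gradient in terms of inner products in `L²`. -/
theorem isO2_iff {F : ScalarL2} {g : VectorL2} :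
    IsO2 F g ↔ nrm g = 0 ∧ ∀ w : Fin 3 → Smooth, (∀ ξ : Sph, ⟪(ξ : E3), vec w ξ⟫_ℝ = 0) →
      ⟪g, vm w⟫_ℝ = -⟪F, sm (∑ i, tgrad i (w i))⟫_ℝ := by
  rw [IsO2, nrm_eq_zero_iff]
  refine and_congr_right fun _ => ⟨fun h w hw => ?_, fun h φ hφ ht => ?_⟩
  · have := h (vec w) (contDiff_vec w) hw
    simp only [surfaceDiv_vec] at this
    rw [inner_vm_right, this, inner_sm_right]
  · obtain ⟨w, rfl⟩ : ∃ w, φ = vec w := ⟨_, (vec_comps φ hφ).symm⟩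
    have := h w ht
    rw [inner_vm_right, inner_sm_right] at this
    simpa only [surfaceDiv_vec] using this

theorem isO2_sm (Φ : Smooth) : IsO2 (sm Φ) (vm (gradF Φ)) := by
  refine isO2_iff.2 ⟨nrm_vm_gradF Φ, fun w hw => ?_⟩
  have h := integral_inner_tgrad Φ (vec w) (contDiff_vec w) hw
  rw [inner_sm_sm, inner_vm_vm]
  simp only [surfaceDiv_vec, inner_eq_sum] at h
  rw [← h]
  simp [gradF]

/-- The graph of the weak surface gradient. -/
noncomputable def gradGraph : Submodule ℝ (ScalarL2 × VectorL2) where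
  carrier := {p | IsO2 p.1 p.2}
  zero_mem' := isO2_iff.2 ⟨map_zero _, fun w _ => by simp⟩
  add_mem' := by
    rintro ⟨F, g⟩ ⟨G, h⟩ h1 h2
    have h1 := isO2_iff.1 h1
    have h2 := isO2_iff.1 h2
    refine isO2_iff.2 ⟨?_, fun w hw => ?_⟩
    · change nrm (g + h) = 0
      rw [map_add, h1.1, h2.1, add_zero]
    · change ⟪g + h, _⟫_ℝ = -⟪F + G, _⟫_ℝ
      rw [inner_add_left, inner_add_left, h1.2 w hw, h2.2 w hw]
      ring
  smul_mem' := by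
    rintro c ⟨F, g⟩ h1
    have h1 := isO2_iff.1 h1
    refine isO2_iff.2 ⟨?_, fun w hw => ?_⟩
    · change nrm (c • g) = 0
      rw [map_smul, h1.1, smul_zero]
    · change ⟪c • g, _⟫_ℝ = -⟪c • F, _⟫_ℝ
      rw [inner_smul_left, inner_smul_left, h1.2 w hw]
      ring

theorem mem_gradGraph {F : ScalarL2} {g : VectorL2} : (F, g) ∈ gradGraph ↔ IsO2 F g := Iff.rfl

theorem IsO2.add {F G : ScalarL2} {g h : VectorL2} (h1 : IsO2 F g) (h2 : IsO2 G h) :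
    IsO2 (F + G) (g + h) := by
  have h3 := Submodule.add_mem gradGraph (mem_gradGraph.2 h1) (mem_gradGraph.2 h2)
  rw [Prod.mk_add_mk] at h3
  exact mem_gradGraph.1 h3

theorem IsO2.sub {F G : ScalarL2} {g h : VectorL2} (h1 : IsO2 F g) (h2 : IsO2 G h) :
    IsO2 (F - G) (g - h) := by
  have h3 := Submodule.sub_mem gradGraph (mem_gradGraph.2 h1) (mem_gradGraph.2 h2)
  rw [Prod.mk_sub_mk] at h3
  exact mem_gradGraph.1 h3

theorem IsO2.smul (c : ℝ) {F : ScalarL2} {g : VectorL2} (h1 : IsO2 F g) :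
    IsO2 (c • F) (c • g) := by
  have h3 := Submodule.smul_mem gradGraph c (mem_gradGraph.2 h1)
  rw [Prod.smul_mk] at h3
  exact mem_gradGraph.1 h3

theorem isClosed_gradGraph : IsClosed (gradGraph : Set (ScalarL2 × VectorL2)) := by
  have h : (gradGraph : Set (ScalarL2 × VectorL2)) = {p | nrm p.2 = 0} ∩
      ⋂ (w : Fin 3 → Smooth) (_ : ∀ ξ : Sph, ⟪(ξ : E3), vec w ξ⟫_ℝ = 0),
        {p | ⟪p.2, vm w⟫_ℝ = -⟪p.1, sm (∑ i, tgrad i (w i))⟫_ℝ} := by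
    ext ⟨F, g⟩
    simp only [SetLike.mem_coe, mem_gradGraph, isO2_iff, Set.mem_inter_iff, Set.mem_ofPred_eq,
      Set.mem_iInter]
  rw [h]
  refine IsClosed.inter (isClosed_eq (by fun_prop) (by fun_prop)) ?_
  exact isClosed_iInter fun w => isClosed_iInter fun _ =>
    isClosed_eq (by fun_prop) (by fun_prop)

theorem isO2_const (c : ℝ) : IsO2 (c • sm 1) 0 := by
  have h := (isO2_sm 1).smul c
  have h0 : gradF 1 = 0 := by
    funext i
    simp [gradF]
  rwa [h0, map_zero, smul_zero] at h

theorem IsO2.inner_gradF {F : ScalarL2} {g : VectorL2} (h : IsO2 F g) (Φ : Smooth) :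
    ⟪g, vm (gradF Φ)⟫_ℝ = -⟪F, sm (bel Φ)⟫_ℝ := by
  rw [(isO2_iff.1 h).2 (gradF Φ) fun ξ => by
    rw [inner_pos_vec]
    simp only [gradF, sum_X_mul_tgrad, Smooth.zero_apply]]
  have : sm (∑ i, tgrad i (gradF Φ i)) = sm (bel Φ) := by
    rw [sm_eq_iff]
    intro ξ
    simp only [gradF]
    rw [sum_tgrad_tgrad, Smooth.mul_apply, normSq_sphere, one_mul]
  rw [this]

/-- Gradients are orthogonal to curl gradients, since the latter are free of divergence. -/
theorem IsO2.inner_curlF {F : ScalarL2} {g : VectorL2} (h : IsO2 F g) (Φ : Smooth) :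
    ⟪g, vm (curlF Φ)⟫_ℝ = 0 := by
  rw [(isO2_iff.1 h).2 (curlF Φ) fun ξ => by
    rw [inner_pos_vec]
    simp only [curlF, sum_X_mul_rot, Smooth.zero_apply]]
  simp only [curlF, sum_tgrad_rot, map_zero, inner_zero_right, neg_zero]

theorem IsO2.inner_gradF_harm {F : ScalarL2} {g : VectorL2} (h : IsO2 F g) {n : ℕ} {q : Smooth}
    (hq : q ∈ Harm n) : ⟪g, vm (gradF q)⟫_ℝ = n * (n + 1) * ⟪F, sm q⟫_ℝ := by
  rw [h.inner_gradF, sm_bel_harm hq, inner_smul_right]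
  ring

/-- A function with mean zero vanishes if its weak gradient is orthogonal to all gradients of smooth
functions. -/
theorem IsO2.eq_zero {F : ScalarL2} {g : VectorL2} (h : IsO2 F g)
    (hg : ∀ Φ, ⟪g, vm (gradF Φ)⟫_ℝ = 0) (h0 : proj 0 F = 0) : F = 0 := by
  refine ext_proj fun n => ?_
  rw [map_zero]
  rcases Nat.eq_zero_or_pos n with rfl | hn
  · exact h0
  · refine proj_eq_zero_iff.2 fun q hq => ?_
    have h1 := h.inner_gradF_harm hq
    rw [hg] at h1
    have hn' : (0 : ℝ) < n := by exact_mod_cast hn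
    exact (mul_eq_zero.1 h1.symm).resolve_left (by positivity)

/-- Gradients of spherical harmonics of different degrees are orthogonal. -/
theorem inner_gradF_gradF {n m : ℕ} {p q : Smooth} (hq : q ∈ Harm m) (hp : p ∈ Harm n) :
    ⟪vm (gradF p), vm (gradF q)⟫_ℝ = if n = m then n * (n + 1) * ⟪sm p, sm q⟫_ℝ else 0 := by
  rw [(isO2_sm p).inner_gradF_harm hq]
  split_ifs with h
  · rw [h]
  · rw [orthogonal_harm h hp hq, mul_zero]

/-- Bessel's inequality for the gradients of the harmonic components. -/
theorem IsO2.sum_le {F : ScalarL2} {g : VectorL2} (h : IsO2 F g) (s : Finset ℕ) :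
    ∑ n ∈ s, (n : ℝ) * (n + 1) * ‖proj n F‖ ^ 2 ≤ ‖g‖ ^ 2 := by
  choose q hq hqF using fun n => exists_harm_proj n F
  set v := ∑ n ∈ s, vm (gradF (q n)) with hv
  have h1 : ⟪g, v⟫_ℝ = ∑ n ∈ s, (n : ℝ) * (n + 1) * ‖proj n F‖ ^ 2 := by
    rw [hv, inner_sum]
    refine Finset.sum_congr rfl fun n _ => ?_
    rw [h.inner_gradF_harm (hq n), hqF, inner_proj_self]
  have h2 : ⟪v, v⟫_ℝ = ∑ n ∈ s, (n : ℝ) * (n + 1) * ‖proj n F‖ ^ 2 := by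
    rw [hv, inner_sum]
    refine Finset.sum_congr rfl fun n hn => ?_
    rw [sum_inner, Finset.sum_eq_single_of_mem n hn fun m _ hm => by
      rw [inner_gradF_gradF (hq n) (hq m), if_neg hm]]
    rw [inner_gradF_gradF (hq n) (hq n), if_pos rfl, hqF, real_inner_self_eq_norm_sq]
  have h3 := real_inner_self_nonneg (x := g - v)
  rw [inner_sub_left, inner_sub_right, inner_sub_right, real_inner_comm g v, h2, h1,
    real_inner_self_eq_norm_sq] at h3
  linarith

theorem IsO2.summable {F : ScalarL2} {g : VectorL2} (h : IsO2 F g) :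
    Summable fun n : ℕ => (n : ℝ) * (n + 1) * ‖proj n F‖ ^ 2 :=
  summable_of_sum_le (fun n => by positivity) h.sum_le

/-- Poincaré's inequality. The smallest positive eigenvalue of `-Δ*` is `2`. -/
theorem IsO2.norm_le {F : ScalarL2} {g : VectorL2} (h : IsO2 F g) (h0 : proj 0 F = 0) :
    ‖F‖ ≤ ‖g‖ := by
  rw [← sq_le_sq₀ (norm_nonneg _) (norm_nonneg _)]
  refine hasSum_le_of_sum_le (hasSum_norm_sq_proj F) fun s => le_trans ?_ (h.sum_le s)
  refine Finset.sum_le_sum fun n _ => ?_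
  rcases Nat.eq_zero_or_pos n with rfl | hn
  · simp [h0]
  · have hn' : (1 : ℝ) ≤ n := by exact_mod_cast hn
    exact le_mul_of_one_le_left (by positivity) (by nlinarith)

/-- Square-summability of the gradients of the harmonic components suffices for a weak
gradient. -/
theorem exists_isO2 {F : ScalarL2}
    (h : Summable fun n : ℕ => (n : ℝ) * (n + 1) * ‖proj n F‖ ^ 2) : ∃ g, IsO2 F g := by
  choose q hq hqF using fun n => exists_harm_proj n F
  set G : ℕ → Submodule ℝ VectorL2 := fun n => ℝ ∙ vm (gradF (q n)) with hG
  have hort : OrthogonalFamily ℝ (fun n => G n) fun n => (G n).subtypeₗᵢ := by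
    rintro n m hnm ⟨_, hx⟩ ⟨_, hy⟩
    obtain ⟨a, rfl⟩ := Submodule.mem_span_singleton.1 hx
    obtain ⟨b, rfl⟩ := Submodule.mem_span_singleton.1 hy
    change ⟪a • vm (gradF (q n)), b • vm (gradF (q m))⟫_ℝ = 0
    rw [inner_smul_left, inner_smul_right, inner_gradF_gradF (hq m) (hq n), if_neg hnm]
    simp
  have hsum : Summable fun n => vm (gradF (q n)) := by
    refine (hort.summable_iff_norm_sq_summable
      fun n => ⟨vm (gradF (q n)), Submodule.mem_span_singleton_self _⟩).2 ?_
    convert h using 2 with n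
    change ‖vm (gradF (q n))‖ ^ 2 = _
    rw [← real_inner_self_eq_norm_sq, inner_gradF_gradF (hq n) (hq n), if_pos rfl,
      real_inner_self_eq_norm_sq, hqF]
  refine ⟨∑' n, vm (gradF (q n)), mem_gradGraph.1 ?_⟩
  refine isClosed_gradGraph.mem_of_tendsto ((hasSum_proj F).prodMk hsum.hasSum)
    (Filter.Eventually.of_forall fun s => ?_)
  refine sum_mem fun n _ => ?_
  rw [← hqF]
  exact isO2_sm (q n)

theorem isO3_iff {F : ScalarL2} {h : VectorL2} : IsO3 F h ↔ ∃ g, IsO2 F g ∧ h = crossL g := by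
  refine exists_congr fun g => and_congr_right fun _ => ?_
  rw [Lp.ext_iff]
  constructor
  · intro h1
    filter_upwards [h1, coeFn_crossL g] with ξ h2 h3
    rw [h2, h3]
  · intro h1
    filter_upwards [h1, coeFn_crossL g] with ξ h2 h3
    rw [h2, h3]

/-! ### The Helmholtz decomposition -/

/-- The weak surface gradients of functions with mean zero. -/
noncomputable def gradRange : Submodule ℝ VectorL2 where
  carrier := {g | ∃ F, IsO2 F g ∧ proj 0 F = 0}
  zero_mem' := ⟨0, gradGraph.zero_mem, map_zero _⟩
  add_mem' := by
    rintro g h ⟨F, h1, h2⟩ ⟨G, h3, h4⟩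
    exact ⟨F + G, h1.add h3, by rw [map_add, h2, h4, add_zero]⟩
  smul_mem' := by
    rintro c g ⟨F, h1, h2⟩
    exact ⟨c • F, h1.smul c, by rw [map_smul, h2, smul_zero]⟩

/-- By Poincaré's inequality, a limit of gradients is a gradient. -/
theorem isClosed_gradRange : IsClosed (gradRange : Set VectorL2) := by
  refine isSeqClosed_iff_isClosed.1 fun u g hu hug => ?_
  choose F hF hF0 using hu
  have hC : CauchySeq F := by
    refine Metric.cauchySeq_iff.2 fun ε hε => ?_
    obtain ⟨N, hN⟩ := Metric.cauchySeq_iff.1 hug.cauchySeq ε hε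
    refine ⟨N, fun m hm n hn => lt_of_le_of_lt ?_ (hN m hm n hn)⟩
    rw [dist_eq_norm, dist_eq_norm]
    exact ((hF m).sub (hF n)).norm_le (by rw [map_sub, hF0, hF0, sub_zero])
  obtain ⟨F', hF'⟩ := cauchySeq_tendsto_of_complete hC
  have hmem : ((F', g) : ScalarL2 × VectorL2) ∈ gradGraph :=
    isClosed_gradGraph.mem_of_tendsto (hF'.prodMk_nhds hug)
      (Filter.Eventually.of_forall fun n => mem_gradGraph.2 (hF n))
  have h0 : Filter.Tendsto (fun n => proj 0 (F n)) Filter.atTop (nhds (proj 0 F')) :=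
    ((proj 0).continuous.tendsto F').comp hF'
  simp only [hF0] at h0
  exact ⟨F', mem_gradGraph.1 hmem, tendsto_nhds_unique h0 tendsto_const_nhds⟩

theorem gradF_mem_gradRange (Φ : Smooth) : vm (gradF Φ) ∈ gradRange := by
  obtain ⟨c, hc⟩ := exists_proj_zero_eq (sm Φ)
  have h := (isO2_sm Φ).sub (isO2_const c)
  rw [sub_zero] at h
  refine ⟨_, h, ?_⟩
  rw [map_sub, map_smul, hc, proj_of_mem ⟨1, one_mem_harm, rfl⟩, sub_self]

/-- The Cartesian components of a vector field. -/
noncomputable def compL (i : Fin 3) (g : VectorL2) : ScalarL2 :=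
  (EuclideanSpace.proj (𝕜 := ℝ) i : E3 →L[ℝ] ℝ).compLp g

theorem coeFn_compL (i : Fin 3) (g : VectorL2) : compL i g =ᵐ[surf] fun ξ : Sph => g ξ i :=
  ContinuousLinearMap.coeFn_compLp _ _

theorem inner_compL_sm (i : Fin 3) (g : VectorL2) (Φ : Smooth) :
    ⟪compL i g, sm Φ⟫_ℝ = ⟪g, vm fun j => if i = j then Φ else 0⟫_ℝ := by
  rw [inner_sm_right, inner_vm_right]
  refine integral_congr_ae ?_
  filter_upwards [coeFn_compL i g] with ξ h
  rw [h, inner_eq_sum, Finset.sum_eq_single i]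
  · simp
  · intro j _ hj
    rw [vec_apply, if_neg hj.symm, Smooth.zero_apply, mul_zero]
  · simp

theorem vm_X_mul (Ψ : Smooth) : vm (fun j => X j * Ψ) = o1 (sm Ψ) := by
  refine Lp.ext ?_
  filter_upwards [coeFn_vm fun j => X j * Ψ, coeFn_o1 (sm Ψ), coeFn_sm Ψ] with ξ h1 h2 h3
  rw [h1, h2, h3]
  ext i
  simp [mul_comm]

/-- The Cartesian components of a tangential field that is orthogonal to all gradients and curl
gradients are weakly harmonic on the sphere. -/
theorem inner_compL_bel {t : VectorL2} (hn : nrm t = 0) (hg : ∀ Φ, ⟪t, vm (gradF Φ)⟫_ℝ = 0)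
    (hc : ∀ Φ, ⟪t, vm (curlF Φ)⟫_ℝ = 0) (i : Fin 3) (Φ : Smooth) :
    ⟪compL i t, sm (bel Φ)⟫_ℝ = 0 := by
  have h : vm (fun j => if i = j then bel Φ else 0)
      = vm (gradF (tgrad i Φ)) + vm (curlF (rot i Φ)) + vm (fun j => X j * (X i * bel Φ)) := by
    rw [← map_add, ← map_add]
    refine vm_congr fun ξ j => ?_
    have h1 := congrArg (fun Ψ : Smooth => (Ψ : E3 → ℝ) ξ) (tgrad_tgrad_add_rot_rot i j Φ)
    simp only [Smooth.add_apply, Smooth.mul_apply, Smooth.sub_apply, normSq_sphere, one_mul] at h1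
    simp only [Pi.add_apply, gradF, curlF, Smooth.add_apply, h1, Smooth.mul_apply]
    split_ifs
    · rw [normSq_sphere]
      ring
    · rw [Smooth.zero_apply]
      ring
  rw [inner_compL_sm, h, inner_add_right, inner_add_right, hg, hc, vm_X_mul, real_inner_comm,
    ← inner_nrm, hn, inner_zero_right]
  simp

/-- There are no harmonic tangential fields on the sphere: the Cartesian components of such a field
are orthogonal to all spherical harmonics of positive degree, hence constant, and a constant vector
that is tangential everywhere vanishes. -/
theorem eq_zero_of_orthogonal {t : VectorL2} (hn : nrm t = 0)
    (hg : ∀ Φ, ⟪t, vm (gradF Φ)⟫_ℝ = 0) (hc : ∀ Φ, ⟪t, vm (curlF Φ)⟫_ℝ = 0) : t = 0 := by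
  have hconst : ∀ i, ∃ c : ℝ, compL i t = c • sm 1 := by
    intro i
    obtain ⟨c, hc0⟩ := exists_proj_zero_eq (compL i t)
    refine ⟨c, ext_proj fun n => ?_⟩
    have h1 : sm 1 ∈ HarmL2 0 := ⟨1, one_mem_harm, rfl⟩
    rcases Nat.eq_zero_or_pos n with rfl | hpos
    · rw [hc0, map_smul, proj_of_mem h1]
    · rw [map_smul, proj_of_mem_ne hpos.ne' h1, smul_zero, proj_eq_zero_iff]
      intro q hq
      have h2 := inner_compL_bel hn hg hc i q
      rw [sm_bel_harm hq, inner_smul_right] at h2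
      have hpos' : (0 : ℝ) < n := by exact_mod_cast hpos
      refine (mul_eq_zero.1 h2).resolve_left (neg_ne_zero.2 (by positivity))
  choose c hcc using hconst
  have hae : ∀ i, ∀ᵐ ξ : Sph ∂surf, t ξ i = c i := by
    intro i
    have h1 := coeFn_compL i t
    rw [hcc] at h1
    filter_upwards [h1, Lp.coeFn_smul (c i) (sm 1), coeFn_sm 1] with ξ h2 h3 h4
    rw [← h2, h3, Pi.smul_apply, h4, Smooth.one_apply, smul_eq_mul, mul_one]
  have hlin : sm (∑ i, c i • X i) = sm 0 := by
    rw [map_zero]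
    refine (Lp.eq_zero_iff_ae_eq_zero).2 ?_
    filter_upwards [coeFn_sm (∑ i, c i • X i), ae_all_iff.2 hae, nrm_eq_zero_iff.1 hn]
      with ξ h1 h2 h3
    rw [h1, Pi.zero_apply, ← h3, inner_eq_sum, Smooth.sum_apply]
    refine Finset.sum_congr rfl fun i _ => ?_
    rw [h2, Smooth.smul_apply, X_apply, mul_comm]
  have hc0 : ∀ i, c i = 0 := by
    intro i
    have := sm_eq_iff.1 hlin ⟨EuclideanSpace.single i 1, by simp⟩
    simpa [Pi.single_apply] using this
  refine Lp.eq_zero_iff_ae_eq_zero.2 ?_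
  filter_upwards [ae_all_iff.2 hae] with ξ h
  ext i
  rw [h, hc0]
  rfl

theorem isHelmholtz_iff {f : VectorL2} {F₁ F₂ F₃ : ScalarL2} :
    IsHelmholtz f F₁ F₂ F₃ ↔ proj 0 F₂ = 0 ∧ proj 0 F₃ = 0 ∧
      ∃ g₂ g₃ : VectorL2, IsO2 F₂ g₂ ∧ IsO2 F₃ g₃ ∧ f = o1 F₁ + g₂ + crossL g₃ := by
  rw [IsHelmholtz, proj_zero_eq_zero_iff, proj_zero_eq_zero_iff]
  refine and_congr_right fun _ => and_congr_right fun _ => ?_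
  constructor
  · rintro ⟨g, h, h1, h2, h3⟩
    obtain ⟨g', h4, rfl⟩ := isO3_iff.1 h2
    exact ⟨g, g', h1, h4, h3⟩
  · rintro ⟨g, g', h1, h4, h3⟩
    exact ⟨g, _, h1, isO3_iff.2 ⟨g', h4, rfl⟩, h3⟩

theorem o1_add (F G : ScalarL2) : o1 (F + G) = o1 F + o1 G := map_add o1L F G

theorem o1_sub (F G : ScalarL2) : o1 (F - G) = o1 F - o1 G := map_sub o1L F G

/-- The gradient parts of `f` and of `-ξ ∧ f` are their projections onto the gradients; what remains
of `f` is orthogonal to all gradients and curl gradients. -/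
theorem exists_isHelmholtz (f : VectorL2) : ∃ F₁ F₂ F₃ : ScalarL2, IsHelmholtz f F₁ F₂ F₃ := by
  have : CompleteSpace gradRange := isClosed_gradRange.completeSpace_coe
  obtain ⟨F₂, h2, h20⟩ := gradRange.starProjection_apply_mem f
  obtain ⟨F₃, h3, h30⟩ := gradRange.starProjection_apply_mem (-crossL f)
  set g₂ := gradRange.starProjection f with hg₂
  set g₃ := gradRange.starProjection (-crossL f) with hg₃
  refine ⟨nrm f, F₂, F₃, isHelmholtz_iff.2 ⟨h20, h30, g₂, g₃, h2, h3, ?_⟩⟩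
  rw [← sub_eq_zero]
  have ho1 : ∀ (F : ScalarL2) {g : VectorL2}, nrm g = 0 → ⟪o1 F, g⟫_ℝ = 0 := fun F g hg => by
    rw [← inner_nrm, hg, inner_zero_right]
  refine eq_zero_of_orthogonal ?_ (fun Φ => ?_) fun Φ => ?_
  · rw [map_sub, map_add, map_add, nrm_o1, (isO2_iff.1 h2).1, nrm_crossL]
    simp
  · have h4 := gradRange.starProjection_inner_eq_zero f _ (gradF_mem_gradRange Φ)
    rw [← hg₂, inner_sub_left] at h4
    rw [inner_sub_left, inner_add_left, inner_add_left, ho1 _ (nrm_vm_gradF Φ), inner_crossL,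
      crossL_gradF, h3.inner_curlF]
    linarith
  · have h4 := gradRange.starProjection_inner_eq_zero (-crossL f) _ (gradF_mem_gradRange Φ)
    rw [← hg₃, inner_sub_left, inner_neg_left, inner_crossL, crossL_gradF] at h4
    rw [inner_sub_left, inner_add_left, inner_add_left, ho1 _ (nrm_vm_curlF Φ), h2.inner_curlF,
      inner_crossL, crossL_curlF, inner_neg_right]
    linarith

theorem helmholtz_eq_zero {F₁ F₂ F₃ : ScalarL2} {g₂ g₃ : VectorL2} (h2 : IsO2 F₂ g₂)
    (h3 : IsO2 F₃ g₃) (h20 : proj 0 F₂ = 0) (h30 : proj 0 F₃ = 0)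
    (h : o1 F₁ + g₂ + crossL g₃ = 0) : F₁ = 0 ∧ F₂ = 0 ∧ F₃ = 0 := by
  have h1 : F₁ = 0 := by
    have h4 := congrArg nrm h
    rwa [map_add, map_add, nrm_o1, (isO2_iff.1 h2).1, nrm_crossL, add_zero, add_zero,
      map_zero] at h4
  have ho : o1 F₁ = 0 := by
    rw [h1]
    exact map_zero o1L
  rw [ho, zero_add] at h
  have h4 : ∀ v : VectorL2, ⟪g₂, v⟫_ℝ - ⟪g₃, crossL v⟫_ℝ = 0 := fun v => by
    rw [sub_eq_add_neg, ← inner_crossL, ← inner_add_left, h, inner_zero_left]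
  refine ⟨h1, h2.eq_zero (fun Φ => ?_) h20, h3.eq_zero (fun Φ => ?_) h30⟩
  · have := h4 (vm (gradF Φ))
    rwa [crossL_gradF, h3.inner_curlF, sub_zero] at this
  · have := h4 (vm (curlF Φ))
    rwa [crossL_curlF, inner_neg_right, h2.inner_curlF, zero_sub, neg_neg] at this

theorem isHelmholtz_unique {f : VectorL2} {F₁ F₂ F₃ F₁' F₂' F₃' : ScalarL2}
    (h : IsHelmholtz f F₁ F₂ F₃) (h' : IsHelmholtz f F₁' F₂' F₃') :
    F₁ = F₁' ∧ F₂ = F₂' ∧ F₃ = F₃' := by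
  obtain ⟨a2, a3, g₂, g₃, b2, b3, e⟩ := isHelmholtz_iff.1 h
  obtain ⟨a2', a3', g₂', g₃', b2', b3', e'⟩ := isHelmholtz_iff.1 h'
  have := helmholtz_eq_zero (F₁ := F₁ - F₁') (b2.sub b2') (b3.sub b3')
    (by rw [map_sub, a2, a2', sub_zero]) (by rw [map_sub, a3, a3', sub_zero]) (by
      rw [o1_sub, map_sub, ← sub_eq_zero.2 (e.symm.trans e')]
      abel)
  exact ⟨sub_eq_zero.1 this.1, sub_eq_zero.1 this.2.1, sub_eq_zero.1 this.2.2⟩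

/-! ### The Hardy-Hodge decomposition -/

/-- A function with a weak surface gradient lies in the domain of `D`. -/
theorem IsO2.exists_isD {F : ScalarL2} {g : VectorL2} (h : IsO2 F g) : ∃ G, IsD F G := by
  obtain ⟨G, hG⟩ := exists_proj_eq_smul (fun n : ℕ => (n : ℝ) + 1 / 2) F (by
    convert h.summable.add ((hasSum_norm_sq_proj F).summable.mul_left (1 / 4)) using 2 with n
    ring)
  exact ⟨G, isD_iff.2 hG⟩

theorem exists_isDInv (F : ScalarL2) : ∃ G, IsDInv F G := by
  obtain ⟨G, hG⟩ := exists_proj_eq_smul_of_bdd (fun n : ℕ => ((n : ℝ) + 1 / 2)⁻¹) 4 (fun n => by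
    rw [inv_pow]
    refine inv_le_of_inv_le₀ (by norm_num) ?_
    have : (0 : ℝ) ≤ n := n.cast_nonneg
    nlinarith) F
  refine ⟨G, isDInv_iff.2 fun n => ?_⟩
  rw [hG, smul_smul, mul_inv_cancel₀ (by positivity), one_smul]

theorem exists_isDAddHalfInv (F : ScalarL2) : ∃ G, IsDAddHalfInv F G := by
  obtain ⟨G, hG⟩ := exists_proj_eq_smul_of_bdd (fun n : ℕ => ((n : ℝ) + 1)⁻¹) 1 (fun n => by
    rw [inv_pow]
    refine inv_le_one_of_one_le₀ ?_
    have : (0 : ℝ) ≤ n := n.cast_nonneg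
    nlinarith) F
  refine ⟨G, isDAddHalfInv_iff.2 fun n => ?_⟩
  rw [hG, smul_smul, mul_inv_cancel₀ (by positivity), one_smul]

/-- `(D + 1/2)⁻¹` maps into the functions with square-integrable surface gradients. -/
theorem IsDAddHalfInv.exists_isO2 {F G : ScalarL2} (h : IsDAddHalfInv F G) : ∃ g, IsO2 G g := by
  refine SphereHH.exists_isO2 (Summable.of_nonneg_of_le (fun n => by positivity) (fun n => ?_)
    (hasSum_norm_sq_proj F).summable)
  rw [isDAddHalfInv_iff.1 h n, norm_smul, mul_pow, Real.norm_eq_abs, sq_abs]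
  refine mul_le_mul_of_nonneg_right ?_ (by positivity)
  have : (0 : ℝ) ≤ n := n.cast_nonneg
  nlinarith

/-- The components of degree `n` of the Hardy-Hodge scalars, in terms of those of the Helmholtz
scalars. -/
theorem IsHardyHodge.proj_eq {f : VectorL2} {F₁ F₂ F₃ B₁ B₂ B₃ : ScalarL2}
    (hF : IsHelmholtz f F₁ F₂ F₃) (hB : IsHardyHodge f B₁ B₂ B₃) (n : ℕ) :
    proj n B₁ = (((n : ℝ) + 1) / (2 * n + 1)) • (proj n F₁ - (n : ℝ) • proj n F₂) ∧
    proj n B₂ = ((n : ℝ) / (2 * n + 1)) • (proj n F₁ + ((n : ℝ) + 1) • proj n F₂) ∧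
    proj n B₃ = (n : ℝ) • proj n F₃ := by
  obtain ⟨-, -, _, _, _, ⟨G₁, g₁, hG₁, hg₁, rfl⟩, ⟨G₂, g₂, hG₂, hg₂, rfl⟩, ⟨G₃, hG₃, h₃⟩, hf⟩ := hB
  obtain ⟨g₃, hg₃, rfl⟩ := isO3_iff.1 h₃
  rw [isDAddHalfInv_iff] at hG₁
  rw [isDSubHalfInv_iff] at hG₂ hG₃
  -- the Helmholtz scalars are read off after removing the mean of `G₁`
  obtain ⟨c, hc⟩ := exists_proj_zero_eq G₁
  have h1 : sm 1 ∈ HarmL2 0 := ⟨1, one_mem_harm, rfl⟩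
  have hH : IsHelmholtz f (B₁ + B₂) (G₂ - (G₁ - c • sm 1)) G₃ := by
    refine isHelmholtz_iff.2 ⟨?_, hG₃.1, g₂ - (g₁ - 0), g₃,
      hg₂.sub (hg₁.sub (isO2_const c)), hg₃, ?_⟩
    · rw [map_sub, map_sub, map_smul, hG₂.1, hc, proj_of_mem h1, sub_self, sub_zero]
    · rw [hf, o1_add, sub_zero]
      abel
  obtain ⟨e1, e2, e3⟩ := isHelmholtz_unique hF hH
  have hF20 := (isHelmholtz_iff.1 hF).1
  have hn : (2 * (n : ℝ) + 1) ≠ 0 := by positivity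
  refine ⟨?_, ?_, by rw [e3, hG₃.2]⟩
  · rcases Nat.eq_zero_or_pos n with rfl | hpos
    · rw [e1, map_add, hG₂.2 0]
      simp
    · rw [e1, e2, map_add, map_sub, map_sub, map_smul, proj_of_mem_ne hpos.ne' h1, hG₁, hG₂.2]
      match_scalars <;> field_simp <;> ring
  · rcases Nat.eq_zero_or_pos n with rfl | hpos
    · rw [hG₂.2 0]
      simp
    · rw [e1, e2, map_add, map_sub, map_sub, map_smul, proj_of_mem_ne hpos.ne' h1, hG₁, hG₂.2]
      match_scalars <;> field_simp <;> ring

theorem isHardyHodge_unique {f : VectorL2} {B₁ B₂ B₃ B₁' B₂' B₃' : ScalarL2}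
    (h : IsHardyHodge f B₁ B₂ B₃) (h' : IsHardyHodge f B₁' B₂' B₃') :
    B₁ = B₁' ∧ B₂ = B₂' ∧ B₃ = B₃' := by
  obtain ⟨F₁, F₂, F₃, hF⟩ := exists_isHelmholtz f
  have h1 := IsHardyHodge.proj_eq hF h
  have h2 := IsHardyHodge.proj_eq hF h'
  refine ⟨ext_proj fun n => ?_, ext_proj fun n => ?_, ext_proj fun n => ?_⟩
  · rw [(h1 n).1, (h2 n).1]
  · rw [(h1 n).2.1, (h2 n).2.1]
  · rw [(h1 n).2.2, (h2 n).2.2]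

/-- With `B₁` given by its formula and `G₁ = (D + 1/2)⁻¹ B₁`, the other scalars come from
`B₂ = F₁ - B₁`, `(D - 1/2)⁻¹ B₂ = F₂ + G₁` up to the mean, and `(D - 1/2)⁻¹ B₃ = F₃`. -/
theorem exists_isHardyHodge (f : VectorL2) : ∃ B₁ B₂ B₃ : ScalarL2, IsHardyHodge f B₁ B₂ B₃ := by
  obtain ⟨F₁, F₂, F₃, hF⟩ := exists_isHelmholtz f
  obtain ⟨h20, h30, g₂, g₃, hg₂, hg₃, hf⟩ := isHelmholtz_iff.1 hF
  obtain ⟨U, hU⟩ := exists_isDInv F₁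
  obtain ⟨V, hV⟩ := exists_isDInv F₂
  obtain ⟨W, hW⟩ := hg₂.exists_isD
  obtain ⟨Z, hZ⟩ := hg₃.exists_isD
  set B₁ := (1 / 2 : ℝ) • (F₁ + (1 / 2 : ℝ) • U - W + (1 / 4 : ℝ) • V) with hB₁
  obtain ⟨G₁, hG₁⟩ := exists_isDAddHalfInv B₁
  obtain ⟨g₁, hg₁⟩ := hG₁.exists_isO2
  obtain ⟨c, hc⟩ := exists_proj_zero_eq G₁
  have h1 : sm 1 ∈ HarmL2 0 := ⟨1, one_mem_harm, rfl⟩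
  rw [isDInv_iff] at hU hV
  rw [isD_iff] at hW hZ
  -- `(2 n + 1) G₁ = F₁ - n F₂` in degree `n`
  have hGn : ∀ n : ℕ, proj n F₁ = (2 * (n : ℝ) + 1) • proj n G₁ + (n : ℝ) • proj n F₂ := by
    intro n
    have h2 := isDAddHalfInv_iff.1 hG₁ n
    rw [hB₁, map_smul, map_add, map_sub, map_add, map_smul, map_smul, hU, hW n, hV n] at h2
    have hn1 : ((n : ℝ) + 1) ≠ 0 := by positivity
    refine smul_right_injective _ hn1 ?_
    have h3 : ((n : ℝ) + 1) • proj n G₁ = (((n : ℝ) + 1) / 2) • proj n U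
        - (1 / 2 * (n * (n + 1)) : ℝ) • proj n V := by
      rw [← h2]
      match_scalars <;> ring
    have h4 : ((n : ℝ) + 1) • ((2 * (n : ℝ) + 1) • proj n G₁)
        = (2 * (n : ℝ) + 1) • ((((n : ℝ) + 1) / 2) • proj n U
        - (1 / 2 * (n * (n + 1)) : ℝ) • proj n V) := by
      rw [smul_comm, h3]
    change ((n : ℝ) + 1) • proj n F₁ = ((n : ℝ) + 1) • (_ + _)
    rw [smul_add, h4, hU, hV]
    match_scalars <;> ring
  have hG₂0 : proj 0 (F₂ + (G₁ - c • sm 1)) = 0 := by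
    rw [map_add, map_sub, map_smul, h20, hc, proj_of_mem h1, sub_self, add_zero]
  have hG₂ : IsDSubHalfInv (F₁ - B₁) (F₂ + (G₁ - c • sm 1)) := by
    refine isDSubHalfInv_iff.2 ⟨hG₂0, fun n => ?_⟩
    rw [map_sub, hGn, isDAddHalfInv_iff.1 hG₁]
    rcases Nat.eq_zero_or_pos n with rfl | hn
    · simp
    · rw [map_add, map_sub, map_smul, proj_of_mem_ne hn.ne' h1]
      match_scalars <;> ring
  have hG₃ : IsDSubHalfInv (Z - (1 / 2 : ℝ) • F₃) F₃ := by
    refine isDSubHalfInv_iff.2 ⟨h30, fun n => ?_⟩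
    rw [map_sub, map_smul, hZ]
    match_scalars
    ring
  refine ⟨B₁, F₁ - B₁, Z - (1 / 2 : ℝ) • F₃, hG₂.1, hG₃.1, _, _, _, ⟨G₁, g₁, hG₁, hg₁, rfl⟩,
    ⟨_, _, hG₂, hg₂.add (hg₁.sub (isO2_const c)), rfl⟩,
    ⟨F₃, hG₃, isO3_iff.2 ⟨g₃, hg₃, rfl⟩⟩, ?_⟩
  rw [hf, o1_sub]
  abel

end SphereHH

theorem theorem2p5 (f : SphereHH.VectorL2) :
    -- the Helmholtz scalars of `f` exist and are unique
    (∃! F : SphereHH.ScalarL2 × SphereHH.ScalarL2 × SphereHH.ScalarL2,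
      SphereHH.IsHelmholtz f F.1 F.2.1 F.2.2) ∧
    -- so do the scalars of the Hardy-Hodge decomposition of `f`
    (∃! B : SphereHH.ScalarL2 × SphereHH.ScalarL2 × SphereHH.ScalarL2,
      SphereHH.IsHardyHodge f B.1 B.2.1 B.2.2) ∧
    -- and the latter are given by the former
    (∀ F₁ F₂ F₃ B₁ B₂ B₃ : SphereHH.ScalarL2,
      SphereHH.IsHelmholtz f F₁ F₂ F₃ → SphereHH.IsHardyHodge f B₁ B₂ B₃ →
      ∃ DinvF₁ DF₂ DinvF₂ DF₃ : SphereHH.ScalarL2,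
        SphereHH.IsDInv F₁ DinvF₁ ∧ SphereHH.IsD F₂ DF₂ ∧
        SphereHH.IsDInv F₂ DinvF₂ ∧ SphereHH.IsD F₃ DF₃ ∧
        B₁ = (1 / 2 : ℝ) • (F₁ + (1 / 2 : ℝ) • DinvF₁ - DF₂ + (1 / 4 : ℝ) • DinvF₂) ∧
        B₂ = (1 / 2 : ℝ) • (F₁ - (1 / 2 : ℝ) • DinvF₁ + DF₂ - (1 / 4 : ℝ) • DinvF₂) ∧
        B₃ = DF₃ - (1 / 2 : ℝ) • F₃) := by
  open SphereHH in
  refine ⟨?_, ?_, ?_⟩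
  · obtain ⟨F₁, F₂, F₃, hF⟩ := exists_isHelmholtz f
    refine ⟨(F₁, F₂, F₃), hF, ?_⟩
    rintro ⟨G₁, G₂, G₃⟩ hG
    obtain ⟨rfl, rfl, rfl⟩ := isHelmholtz_unique hG hF
    rfl
  · obtain ⟨B₁, B₂, B₃, hB⟩ := exists_isHardyHodge f
    refine ⟨(B₁, B₂, B₃), hB, ?_⟩
    rintro ⟨C₁, C₂, C₃⟩ hC
    obtain ⟨rfl, rfl, rfl⟩ := isHardyHodge_unique hC hB
    rfl
  · intro F₁ F₂ F₃ B₁ B₂ B₃ hF hB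
    obtain ⟨-, -, g₂, g₃, hg₂, hg₃, -⟩ := isHelmholtz_iff.1 hF
    obtain ⟨U, hU⟩ := exists_isDInv F₁
    obtain ⟨V, hV⟩ := exists_isDInv F₂
    obtain ⟨W, hW⟩ := hg₂.exists_isD
    obtain ⟨Z, hZ⟩ := hg₃.exists_isD
    refine ⟨U, W, V, Z, hU, hW, hV, hZ, ext_proj fun n => ?_, ext_proj fun n => ?_,
      ext_proj fun n => ?_⟩
    · rw [(hB.proj_eq hF n).1, map_smul, map_add, map_sub, map_add, map_smul, map_smul,
        isD_iff.1 hW n, isDInv_iff.1 hU n, isDInv_iff.1 hV n]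
      match_scalars <;> field_simp <;> ring
    · rw [(hB.proj_eq hF n).2.1, map_smul, map_sub, map_add, map_sub, map_smul, map_smul,
        isD_iff.1 hW n, isDInv_iff.1 hU n, isDInv_iff.1 hV n]
      match_scalars <;> field_simp <;> ring
    · rw [(hB.proj_eq hF n).2.2, map_sub, map_smul, isD_iff.1 hZ n]
      match_scalars
      ring
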